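/- Let $P,Q\in\mathbb{C}[x,y]$ be polynomials whose Jacobian $P_xQ_y-P_yQ_x$ is a nonzero constant, and let $f=(P,Q):\mathbb{C}^2\to\mathbb{C}^2$. Suppose that $\deg P=Kd$ and $\deg Q=Ke$ (total degrees) with natural numbers $K,d,e$, $\gcd(d,e)=1$, and that $P$ and $Q$ are monic in $y$ up to nonzero constants $A,B\in\mathbb{C}$, that is, $$P(x,y)=Ay^{Kd}+\dots+a_1(x)y+a_0(x),\qquad Q(x,y)=By^{Ke}+\dots+b_1(x)y+b_0(x),\qquad A\ne0,\ B\neq 0,$$ with $a_i,b_j\in\mathbb{C}[x]$. Let $A_f$ be the non-proper value set of $f$, i.e. the set of all $a\in\mathbb{C}^2$ such that $f^{-1}(N)$ is not compact for every compact neighbourhood $N$ of $a$. If $A_f\neq\emptyset$, then for every irreducible component $\ell$ of $A_f$ (with respect to the Zariski topology of $\mathbb{C}^2$) there are an integer $m\ge1$ and polynomials $p,q\in\mathbb{C}[\xi]$ of the form $$p(\xi)=A\xi^{md}+\text{lower terms in }\xi,\qquad q(\xi)=B\xi^{me}+\text{lower terms in }\xi,$$ such that $\ell=\{(p(\xi),q(\xi)):\xi\in\mathbb{C}\}$.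 -/

import Mathlib

open scoped Topology

noncomputable section

namespace PlanePoly

/-- The affine plane `ℂ²`; coordinate `0` is `x` (resp. `u`), coordinate `1` is `y` (resp. `v`). -/
abbrev Plane : Type := Fin 2 → ℂ

/-- Polynomials in `x = X 0` and `y = X 1`. -/
abbrev Poly : Type := MvPolynomial (Fin 2) ℂ

/-- The polynomial map `(P, Q) : ℂ² → ℂ²`. -/
def polyMap (P Q : Poly) : Plane → Plane :=
  fun z => ![MvPolynomial.eval z P, MvPolynomial.eval z Q]

/-- The Jacobian determinant `P_x Q_y - P_y Q_x`. -/
def jacobian (P Q : Poly) : Poly :=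
  MvPolynomial.pderiv 0 P * MvPolynomial.pderiv 1 Q -
    MvPolynomial.pderiv 1 P * MvPolynomial.pderiv 0 Q

/-- `P(x, y) = c y ^ n + a_{n-1}(x) y ^ (n-1) + ... + a_1(x) y + a_0(x)` with a nonzero
constant `c`. -/
def IsMonicInY (P : Poly) (n : ℕ) (c : ℂ) : Prop :=
  c ≠ 0 ∧ ∃ a : Fin n → Polynomial ℂ,
    P = MvPolynomial.C c * MvPolynomial.X 1 ^ n +
      ∑ i : Fin n, Polynomial.aeval (MvPolynomial.X 0 : Poly) (a i) *
        MvPolynomial.X 1 ^ (i : ℕ)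

/-- The non-proper value set of `f`: the points `a` such that `f ⁻¹(K)` is not compact for
every compact neighbourhood `K` of `a` (Euclidean topology). -/
def nonProperValueSet (f : Plane → Plane) : Set Plane :=
  {a | ∀ K ∈ 𝓝 a, IsCompact K → ¬ IsCompact (f ⁻¹' K)}

/-- The Zariski topology on `ℂ²`, generated by the complements of the zero sets of
polynomials. It is not an instance: `Plane` carries its Euclidean topology by default. -/
abbrev zariski : TopologicalSpace Plane :=
  TopologicalSpace.generateFrom
    {U | ∃ g : Poly, U = {z | MvPolynomial.eval z g ≠ 0}}

/-- `Z` is an irreducible component of `S ⊆ ℂ²`: a maximal Zariski-irreducible subset of `S`. -/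
def IsIrreducibleComponent (Z S : Set Plane) : Prop :=
  Maximal (fun T : Set Plane => T ⊆ S ∧ @IsIrreducible Plane zariski T) Z

end PlanePoly

end

/-!
In the chart `x = t ^ (-m)`, `y = t ^ (-m) * Y` at infinity, `P` and `Q` become, up to powers of
`t`, polynomials in `Y` over `ℂ[t]`. By the Newton–Puiseux theorem they factor, for suitable `m` and
modulo a high power of `t`, into `Y - u i` and `Y - v j` with `u i, v j ∈ ℂ[t]`. A non-proper value
is a limit of `(P, Q)` along a branch with `t → 0` and `Y` bounded; let `w` be the root `u i` or
`v j` closest to that branch.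

Substitute `Y = w(t) + t ^ k * ξ` for `k = 0, 1, 2, …`. The lowest order terms of `P` and `Q` are
powers of `t` times polynomials `p` and `q` in `ξ`, and the Jacobian condition makes a weighted
Wronskian of `p` and `q` constant. As long as `P` and `Q` have poles at `t = 0`, this forces the
pole orders and the degrees of `p` and `q` to stay in the ratio `d : e`, and the leading
coefficients of `p ^ e` and `q ^ d` in the ratio `A ^ e : B ^ d`. All exponents are multiples of a
large factorial, so the pole orders cannot jump over zero: for some `k` both poles disappear
simultaneously. For this `k` the curve `(p(ξ), q(ξ))` consists of non-proper values, and the given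
one lies on it. Rescaling `ξ` turns the leading coefficients into `A` and `B`. Since there are
finitely many roots `w`, finitely many irreducible closed curves of this form cover the non-proper
value set, so they include all its components.
-/

open Polynomial

/-! ### The Newton–Puiseux theorem -/

namespace Puiseux

section CompleteLocalRing

open IsLocalRing

variable {A : Type*} [CommRing A]

theorem dvd_of_coe_dvd_coe {I : Ideal A} [IsHausdorff I A] {D F : A[X]}
    (hD : D.IsDistinguishedAt I) (h : (D : PowerSeries A) ∣ F) : D ∣ F := by
  obtain ⟨g, hg⟩ := h
  rcases eq_or_ne I ⊤ with rfl | hI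
  · have := ‹IsHausdorff ⊤ A›.subsingleton
    exact ⟨0, Subsingleton.elim _ _⟩
  have : Nontrivial A := ⟨0, 1, fun h01 => hI (I.eq_top_iff_one.2 (h01 ▸ I.zero_mem))⟩
  have horder : ENat.toNat D.natDegree = _ := congrArg ENat.toNat (hD.coe_natDegree_eq_order_map D 1
    (by rwa [PowerSeries.constantCoeff_one, ← Ideal.ne_top_iff_one]) (by simp))
  have hlt : (F %ₘ D).degree < ((PowerSeries.map (Ideal.Quotient.mk I)
      (D : PowerSeries A)).order.toNat : ℕ) := by
    rw [← horder, ENat.toNat_natCast, ← degree_eq_natDegree hD.monic.ne_zero]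
    exact degree_modByMonic_lt _ hD.monic
  rw [← modByMonic_eq_zero_iff_dvd hD.monic]
  refine (hD.isWeierstrassDivisorAt'.eq_of_mul_add_eq_mul_add (q := (F /ₘ D : A[X])) (q' := g)
    (r' := 0) hlt (by simp) ?_).2
  rw [coe_zero, add_zero, ← hg, ← coe_mul, ← coe_add, add_comm, modByMonic_add_div]

variable [IsLocalRing A]

theorem isDistinguishedAt_maximalIdeal_iff {F : A[X]} (hF : F.Monic) :
    F.IsDistinguishedAt (maximalIdeal A) ↔ F.map (residue A) = X ^ F.natDegree := by
  refine ⟨fun h => h.map_eq_X_pow, fun h => ⟨⟨fun {i} hi => ?_⟩, hF⟩⟩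
  rw [← residue_eq_zero_iff, ← coeff_map, h, coeff_X_pow, if_neg hi.ne]

theorem taylor_X_pow_of_nextCoeff_eq_zero {K : Type*} [Field K] [CharZero K] {n : ℕ} {c : K}
    (h : (taylor c (X ^ n)).nextCoeff = 0) : taylor c (X ^ n) = X ^ n := by
  rw [taylor_X_pow, (monic_X_add_C c).nextCoeff_pow, nextCoeff_X_add_C] at h
  rcases smul_eq_zero.1 h with rfl | rfl
  · simp
  · rw [taylor_zero]

theorem not_isDistinguishedAt_taylor [CharZero (ResidueField A)] {F : A[X]} (hF : F.Monic)
    (hnext : F.nextCoeff = 0) (h : ¬ F.IsDistinguishedAt (maximalIdeal A)) (a : A) :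
    ¬ (taylor a F).IsDistinguishedAt (maximalIdeal A) := by
  have hmonic : (taylor a F).Monic := (leadingCoeff_taylor a F).trans hF
  rw [isDistinguishedAt_maximalIdeal_iff hmonic, map_taylor, natDegree_taylor]
  rw [isDistinguishedAt_maximalIdeal_iff hF] at h
  intro hpow
  have hmap : F.map (residue A) = taylor (-residue A a) (X ^ F.natDegree) := by
    rw [← hpow, taylor_taylor, neg_add_cancel, taylor_zero]
  have hnext' : (F.map (residue A)).nextCoeff = 0 := by
    rw [nextCoeff_map_of_leadingCoeff_ne_zero (hf := by simp [hF.leadingCoeff]), hnext, map_zero]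
  exact h (hmap.trans (taylor_X_pow_of_nextCoeff_eq_zero (hmap ▸ hnext')))

variable [IsAdicComplete (maximalIdeal A) A]

theorem exists_monic_mul_of_coeff_zero_mem {F : A[X]} (hF : F.Monic)
    (h0 : F.coeff 0 ∈ maximalIdeal A) (h1 : ¬ F.IsDistinguishedAt (maximalIdeal A)) :
    ∃ D E : A[X], D.Monic ∧ E.Monic ∧ D.natDegree ≠ 0 ∧ E.natDegree ≠ 0 ∧ F = D * E := by
  have hne : PowerSeries.map (residue A) (F : PowerSeries A) ≠ 0 := fun h => by
    simpa [hF.coeff_natDegree] using congrArg (PowerSeries.coeff F.natDegree) h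
  obtain ⟨D, u, hDu⟩ := PowerSeries.exists_isWeierstrassFactorization hne
  have hD := hDu.isDistinguishedAt
  obtain ⟨E, rfl⟩ := dvd_of_coe_dvd_coe hD ⟨u, hDu.eq_mul⟩
  have hE := hD.monic.of_mul_monic_left hF
  refine ⟨D, E, hD.monic, hE, fun h => ?_, fun h => ?_, rfl⟩
  · obtain rfl := hD.monic.natDegree_eq_zero.1 h
    have hu : u = E := by simpa using hDu.eq_mul.symm
    have hunit := PowerSeries.isUnit_constantCoeff _ (hu ▸ hDu.isUnit)
    exact (mem_maximalIdeal _).1 h0 (by simpa using hunit)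
  · obtain rfl := hE.natDegree_eq_zero.1 h
    exact h1 (by simpa using hD)

theorem exists_monic_mul_of_nextCoeff_eq_zero [IsAlgClosed (ResidueField A)]
    [CharZero (ResidueField A)] {F : A[X]} (hF : F.Monic) (hnext : F.nextCoeff = 0)
    (h : ¬ F.IsDistinguishedAt (maximalIdeal A)) :
    ∃ D E : A[X], D.Monic ∧ E.Monic ∧ D.natDegree ≠ 0 ∧ E.natDegree ≠ 0 ∧ F = D * E := by
  have hdeg : F.natDegree ≠ 0 := fun h0 => h ⟨⟨fun hi => by omega⟩, hF⟩
  obtain ⟨b, hb⟩ := IsAlgClosed.exists_root (F.map (residue A)) (by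
    rw [hF.degree_map]
    exact fun h0 => hdeg (natDegree_eq_of_degree_eq_some h0))
  obtain ⟨a, rfl⟩ := residue_surjective b
  obtain ⟨D, E, hD, hE, hD0, hE0, hDE⟩ := exists_monic_mul_of_coeff_zero_mem
    ((leadingCoeff_taylor a F).trans hF)
    (by rwa [taylor_coeff_zero, ← residue_eq_zero_iff, ← eval₂_at_apply, ← eval_map])
    (not_isDistinguishedAt_taylor hF hnext h a)
  refine ⟨taylor (-a) D, taylor (-a) E, (leadingCoeff_taylor _ _).trans hD,
    (leadingCoeff_taylor _ _).trans hE, by rwa [natDegree_taylor], by rwa [natDegree_taylor], ?_⟩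
  rw [← taylor_mul, ← hDE, taylor_taylor, neg_add_cancel, taylor_zero]

end CompleteLocalRing

theorem exists_scaleRoots_eq {R : Type*} [CommSemiring R] {F : R[X]} {π : R}
    (h : ∀ i ≤ F.natDegree, π ^ (F.natDegree - i) ∣ F.coeff i) :
    ∃ E : R[X], E.scaleRoots π = F := by
  rcases eq_or_ne F 0 with rfl | hF
  · exact ⟨0, zero_scaleRoots π⟩
  choose! b hb using h
  set n := F.natDegree with hn
  let E : R[X] := ∑ i ∈ Finset.range (n + 1), C (b i) * X ^ i
  have hcoeff (i : ℕ) : E.coeff i = if i ≤ n then b i else 0 := by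
    simp [E, coeff_X_pow, Finset.mem_range]
  have hEn : E.coeff n = F.leadingCoeff := by
    rw [hcoeff, if_pos le_rfl, leadingCoeff, ← hn, hb n le_rfl, Nat.sub_self, pow_zero, one_mul]
  have hdeg : E.natDegree = n := by
    refine natDegree_eq_of_le_of_coeff_ne_zero (natDegree_le_iff_coeff_eq_zero.2 fun i hi => ?_)
      (hEn ▸ leadingCoeff_ne_zero.2 hF)
    rw [hcoeff, if_neg (not_le.2 hi)]
  refine ⟨E, ext fun i => ?_⟩
  rw [coeff_scaleRoots, hdeg, hcoeff]
  split_ifs with hi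
  · rw [hb i hi, mul_comm]
  · rw [zero_mul, coeff_eq_zero_of_natDegree_lt (hn ▸ not_le.1 hi)]

theorem nextCoeff_taylor {R : Type*} [CommRing R] (F : R[X]) (a : R) :
    (taylor a F).nextCoeff = F.nextCoeff + F.natDegree * (F.leadingCoeff * a) := by
  rcases Nat.eq_zero_or_pos F.natDegree with h0 | hpos
  · simp [nextCoeff, h0]
  obtain ⟨m, hm⟩ := Nat.exists_eq_add_of_lt hpos
  rw [zero_add] at hm
  have hle : (hasseDeriv m F).natDegree ≤ 1 := (natDegree_hasseDeriv_le _ _).trans (by omega)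
  rw [nextCoeff_of_natDegree_pos (by rwa [natDegree_taylor]), nextCoeff_of_natDegree_pos hpos,
    natDegree_taylor, taylor_coeff, leadingCoeff, hm, Nat.add_sub_cancel,
    eq_X_add_C_of_natDegree_le_one hle, hasseDeriv_coeff, hasseDeriv_coeff, zero_add, add_comm 1 m,
    Nat.choose_succ_self_right]
  simp
  ring

theorem nextCoeff_scaleRoots {R : Type*} [CommSemiring R] (F : R[X]) (π : R) :
    (F.scaleRoots π).nextCoeff = F.nextCoeff * π := by
  rcases Nat.eq_zero_or_pos F.natDegree with h0 | hpos
  · simp [nextCoeff, h0]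
  · rw [nextCoeff_of_natDegree_pos hpos,
      nextCoeff_of_natDegree_pos (by rwa [natDegree_scaleRoots]), coeff_scaleRoots,
      natDegree_scaleRoots, Nat.sub_sub_self hpos, pow_one]

theorem exists_nextCoeff_taylor_eq_zero {R : Type*} [CommRing R] {F : R[X]} (hF : F.Monic)
    (hn : IsUnit (F.natDegree : R)) : ∃ a : R, (taylor a F).nextCoeff = 0 := by
  obtain ⟨ν, hν⟩ := hn.exists_right_inv
  refine ⟨-(ν * F.nextCoeff), ?_⟩
  rw [nextCoeff_taylor, hF.leadingCoeff]
  linear_combination (-F.nextCoeff) * hν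

variable {𝕜 : Type*} [Field 𝕜]

/-- The substitution `t ↦ t ^ s` on power series, as a ring homomorphism. -/
noncomputable abbrev expandHom (𝕜 : Type*) [Field 𝕜] (s : ℕ) (hs : s ≠ 0) :
    PowerSeries 𝕜 →+* PowerSeries 𝕜 :=
  (PowerSeries.expand s hs : PowerSeries 𝕜 →ₐ[𝕜] PowerSeries 𝕜)

theorem X_pow_dvd_expandHom_iff {s : ℕ} (hs : s ≠ 0) (m : ℕ) (φ : PowerSeries 𝕜) :
    PowerSeries.X ^ m ∣ expandHom 𝕜 s hs φ ↔ (m : ℕ∞) ≤ s * φ.order := by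
  rw [pow_dvd_iff_le_emultiplicity, ← PowerSeries.order_eq_emultiplicity_X, RingHom.coe_coe,
    PowerSeries.order_expand, nsmul_eq_mul]

theorem exists_newton_slope {F : (PowerSeries 𝕜)[X]} (h : ∃ i, i < F.natDegree ∧ F.coeff i ≠ 0) :
    ∃ (s : ℕ) (hs : s ≠ 0) (r : ℕ),
      (∀ i < F.natDegree, PowerSeries.X ^ (r * (F.natDegree - i)) ∣
        expandHom 𝕜 s hs (F.coeff i)) ∧
      ∃ i < F.natDegree, ¬ PowerSeries.X ^ (r * (F.natDegree - i) + 1) ∣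
        expandHom 𝕜 s hs (F.coeff i) := by
  set n := F.natDegree
  obtain ⟨i₀, ⟨hi₀, hne⟩, hmin⟩ := Set.exists_min_image {i | i < n ∧ F.coeff i ≠ 0}
    (fun i => ((F.coeff i).order.toNat : ℚ) / (n - i : ℕ))
    ((Set.finite_lt_nat n).subset fun _ hi => hi.1) h
  refine ⟨n - i₀, by omega, (F.coeff i₀).order.toNat, fun i hi => ?_, i₀, hi₀, ?_⟩
  · rw [X_pow_dvd_expandHom_iff]
    rcases eq_or_ne (F.coeff i) 0 with h0 | h0
    · have : ((n - i₀ : ℕ) : ℕ∞) ≠ 0 := by exact_mod_cast (by omega : n - i₀ ≠ 0)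
      rw [h0, PowerSeries.order_zero, ENat.mul_top this]
      exact le_top
    · have hi' := hmin i ⟨hi, h0⟩
      rw [div_le_div_iff₀ (by exact_mod_cast (by omega)) (by exact_mod_cast (by omega))] at hi'
      rw [← PowerSeries.coe_toNat_order h0, mul_comm ((n - i₀ : ℕ) : ℕ∞)]
      exact_mod_cast hi'
  · rw [X_pow_dvd_expandHom_iff, ← PowerSeries.coe_toNat_order hne, mul_comm]
    exact_mod_cast Nat.not_succ_le_self _

theorem exists_scaleRoots_eq_map_expandHom {F : (PowerSeries 𝕜)[X]} (hF : F.Monic)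
    (hX : F ≠ X ^ F.natDegree) :
    ∃ (s : ℕ) (hs : s ≠ 0) (r : ℕ) (E : (PowerSeries 𝕜)[X]),
      ¬ E.IsDistinguishedAt (IsLocalRing.maximalIdeal (PowerSeries 𝕜)) ∧
      E.scaleRoots (PowerSeries.X ^ r) = F.map (expandHom 𝕜 s hs) := by
  have hcoeff : ∃ i, i < F.natDegree ∧ F.coeff i ≠ 0 := by
    by_contra! h
    refine hX ((hF.as_sum).trans ?_)
    rw [Finset.sum_eq_zero fun i hi => by rw [h i (Finset.mem_range.1 hi), C_0, zero_mul],
      add_zero]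
  obtain ⟨s, hs, r, hdvd, i, hi, hndvd⟩ := exists_newton_slope hcoeff
  have hdeg : (F.map (expandHom 𝕜 s hs)).natDegree = F.natDegree := hF.natDegree_map _
  obtain ⟨E, hE⟩ := exists_scaleRoots_eq (F := F.map (expandHom 𝕜 s hs))
    (π := PowerSeries.X ^ r) (fun j hj => by
      rw [coeff_map, ← pow_mul, hdeg]
      rcases (hdeg ▸ hj).lt_or_eq with hj | rfl
      · exact hdvd j hj
      · simp)
  have hEdeg : E.natDegree = F.natDegree := by rw [← hdeg, ← hE, natDegree_scaleRoots]
  refine ⟨s, hs, r, E, fun hdist => hndvd ?_, hE⟩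
  have hmem := hdist.mem (hEdeg ▸ hi)
  rw [PowerSeries.maximalIdeal_eq_span_X, Ideal.mem_span_singleton] at hmem
  rw [← coeff_map, ← hE, coeff_scaleRoots, hEdeg, ← pow_mul, pow_succ']
  exact mul_dvd_mul_right hmem _

/-- A polynomial over `𝕜⟦t⟧` *splits after ramification* if it splits after a substitution
`t ↦ t ^ s`. For monic polynomials this says that all roots are Puiseux series. -/
def SplitsAfterRamification (F : (PowerSeries 𝕜)[X]) : Prop :=
  ∃ (s : ℕ) (hs : s ≠ 0), (F.map (expandHom 𝕜 s hs)).Splits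

theorem map_expandHom_mul (F : (PowerSeries 𝕜)[X]) {r s : ℕ} (hr : r ≠ 0) (hs : s ≠ 0) :
    F.map (expandHom 𝕜 (r * s) (mul_ne_zero hr hs)) =
      (F.map (expandHom 𝕜 s hs)).map (expandHom 𝕜 r hr) := by
  rw [Polynomial.map_map]
  congr 1
  exact RingHom.ext fun φ => PowerSeries.expand_mul r hr s hs φ

theorem SplitsAfterRamification.of_map {F : (PowerSeries 𝕜)[X]} {s : ℕ} (hs : s ≠ 0)
    (h : SplitsAfterRamification (F.map (expandHom 𝕜 s hs))) : SplitsAfterRamification F := by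
  obtain ⟨r, hr, h⟩ := h
  exact ⟨r * s, mul_ne_zero hr hs, by rwa [map_expandHom_mul]⟩

theorem SplitsAfterRamification.mul {F G : (PowerSeries 𝕜)[X]} (hF : SplitsAfterRamification F)
    (hG : SplitsAfterRamification G) : SplitsAfterRamification (F * G) := by
  obtain ⟨r, hr, hF⟩ := hF
  obtain ⟨s, hs, hG⟩ := hG
  refine ⟨s * r, mul_ne_zero hs hr, ?_⟩
  rw [Polynomial.map_mul]
  refine .mul ?_ ?_
  · rw [map_expandHom_mul F hs hr]
    exact hF.map _
  · simp only [mul_comm s r]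
    rw [map_expandHom_mul G hr hs]
    exact hG.map _

theorem SplitsAfterRamification.taylor {F : (PowerSeries 𝕜)[X]} (hF : SplitsAfterRamification F)
    (a : PowerSeries 𝕜) : SplitsAfterRamification (taylor a F) := by
  obtain ⟨s, hs, hF⟩ := hF
  exact ⟨s, hs, by rw [map_taylor]; exact hF.taylor _⟩

theorem SplitsAfterRamification.scaleRoots {F : (PowerSeries 𝕜)[X]} (hF : F.Monic)
    (h : SplitsAfterRamification F) (a : PowerSeries 𝕜) :
    SplitsAfterRamification (F.scaleRoots a) := by
  obtain ⟨s, hs, h⟩ := h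
  exact ⟨s, hs, by
    rw [map_scaleRoots _ _ _ (by simp [hF.leadingCoeff])]
    exact h.scaleRoots _⟩

theorem SplitsAfterRamification.of_nextCoeff_eq_zero [IsAlgClosed 𝕜] [CharZero 𝕜]
    {F : (PowerSeries 𝕜)[X]} (hF : F.Monic) (hnext : F.nextCoeff = 0)
    (ih : ∀ E : (PowerSeries 𝕜)[X], E.natDegree < F.natDegree → E.Monic →
      SplitsAfterRamification E) : SplitsAfterRamification F := by
  by_cases hX : F = X ^ F.natDegree
  · refine ⟨1, one_ne_zero, ?_⟩
    rw [hX, Polynomial.map_pow, map_X]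
    exact .X_pow _
  obtain ⟨s, hs, r, E, hdist, hE⟩ := exists_scaleRoots_eq_map_expandHom hF hX
  have hEm : E.Monic := by
    rw [← monic_scaleRoots_iff (PowerSeries.X ^ r), hE]
    exact hF.map _
  have hdeg : E.natDegree = F.natDegree := by
    rw [← natDegree_scaleRoots E (PowerSeries.X ^ r), hE, hF.natDegree_map]
  have hEnext : E.nextCoeff = 0 := by
    have h := nextCoeff_scaleRoots E (PowerSeries.X ^ r)
    rw [hE, nextCoeff_map_of_leadingCoeff_ne_zero (hf := by simp [hF.leadingCoeff]), hnext,
      map_zero] at h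
    exact (mul_eq_zero.1 h.symm).resolve_right (pow_ne_zero r PowerSeries.X_ne_zero)
  refine .of_map hs (hE ▸ .scaleRoots hEm ?_ _)
  have e : IsLocalRing.ResidueField (PowerSeries 𝕜) ≃+* 𝕜 := PowerSeries.residueFieldOfPowerSeries
  have := IsAlgClosed.of_ringEquiv _ _ e.symm
  have : CharZero (IsLocalRing.ResidueField (PowerSeries 𝕜)) :=
    charZero_of_injective_ringHom (f := e.symm.toRingHom) e.symm.injective
  have : IsAdicComplete (IsLocalRing.maximalIdeal (PowerSeries 𝕜)) (PowerSeries 𝕜) := by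
    rw [PowerSeries.maximalIdeal_eq_span_X]
    infer_instance
  obtain ⟨D, D', hD, hD', hD0, hD0', rfl⟩ :=
    exists_monic_mul_of_nextCoeff_eq_zero hEm hEnext hdist
  rw [hD.natDegree_mul hD'] at hdeg
  exact (ih D (by omega) hD).mul (ih D' (by omega) hD')

theorem splitsAfterRamification [IsAlgClosed 𝕜] [CharZero 𝕜] {F : (PowerSeries 𝕜)[X]}
    (hF : F.Monic) : SplitsAfterRamification F := by
  induction hn : F.natDegree using Nat.strong_induction_on generalizing F with
  | _ n ih =>
    subst hn
    rcases Nat.eq_zero_or_pos F.natDegree with h0 | hpos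
    · exact ⟨1, one_ne_zero, by simp [hF.natDegree_eq_zero.1 h0]⟩
    have hunit : IsUnit (F.natDegree : PowerSeries 𝕜) := by
      rw [← map_natCast (PowerSeries.C (R := 𝕜))]
      exact (isUnit_iff_ne_zero.2 (by exact_mod_cast hpos.ne')).map _
    obtain ⟨a, ha⟩ := exists_nextCoeff_taylor_eq_zero hF hunit
    have hG : SplitsAfterRamification (taylor a F) :=
      .of_nextCoeff_eq_zero ((leadingCoeff_taylor a F).trans hF) ha fun E hlt hE =>
        ih _ (by rwa [natDegree_taylor] at hlt) hE rfl
    simpa [taylor_taylor] using hG.taylor (-a)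

theorem exists_eq_prod_X_sub_C {R : Type*} [CommRing R] [IsDomain R] {F : R[X]} {n : ℕ}
    (hF : F.Monic) (hn : F.natDegree = n) (h : F.Splits) :
    ∃ u : Fin n → R, F = ∏ i, (X - C (u i)) := by
  obtain rfl : n = F.roots.toList.length := by
    rw [← hn, h.natDegree_eq_card_roots, Multiset.length_toList]
  refine ⟨F.roots.toList.get, ?_⟩
  conv_lhs => rw [h.eq_prod_roots_of_monic hF, ← F.roots.coe_toList, Multiset.map_coe,
    Multiset.prod_coe]
  exact (Fin.prod_univ_fun_getElem _ _).symm

theorem C_dvd_prod_X_sub_C_sub_prod {R ι : Type*} [CommRing R] [Fintype ι] {a : R} {u v : ι → R}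
    (h : ∀ i, a ∣ u i - v i) : C a ∣ ∏ i, (X - C (u i)) - ∏ i, (X - C (v i)) := by
  rw [← Ideal.mem_span_singleton, ← SModEq.sub_mem]
  refine SModEq.prod fun i _ => SModEq.sub_mem.2 (Ideal.mem_span_singleton.2 ?_)
  rw [sub_sub_sub_cancel_left, ← C_sub, ← neg_sub, C_neg, dvd_neg]
  exact map_dvd C (h i)

theorem coe_expand {s : ℕ} (hs : s ≠ 0) (p : 𝕜[X]) :
    ((expand 𝕜 s p : 𝕜[X]) : PowerSeries 𝕜) = expandHom 𝕜 s hs (p : PowerSeries 𝕜) := by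
  ext i
  rw [coeff_coe, coeff_expand (Nat.pos_of_ne_zero hs), RingHom.coe_coe, PowerSeries.coeff_expand,
    coeff_coe]

theorem X_pow_dvd_coe_iff {p : 𝕜[X]} {N : ℕ} :
    (PowerSeries.X : PowerSeries 𝕜) ^ N ∣ (p : PowerSeries 𝕜) ↔ X ^ N ∣ p := by
  simp only [PowerSeries.X_pow_dvd_iff, Polynomial.X_pow_dvd_iff, coeff_coe]

theorem X_pow_dvd_sub_trunc (u : PowerSeries 𝕜) (N : ℕ) :
    (PowerSeries.X : PowerSeries 𝕜) ^ N ∣ u - (PowerSeries.trunc N u : PowerSeries 𝕜) := by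
  rw [PowerSeries.X_pow_dvd_iff]
  intro m hm
  rw [map_sub, coeff_coe, PowerSeries.coeff_trunc, if_pos hm, sub_self]

/-- `G` is congruent modulo `t ^ N` to `a * ∏ i, (Y - u i)`, where `𝕜[X][X]` is read as `𝕜[t][Y]`:
the `u i` are truncations of the Puiseux series at which `G` vanishes. -/
def HasApproxRoots {ι : Type*} [Fintype ι] (G : 𝕜[X][X]) (a : 𝕜) (u : ι → 𝕜[X]) (N : ℕ) : Prop :=
  C (X ^ N) ∣ G - C (C a) * ∏ i, (X - C (u i))

theorem HasApproxRoots.map_expand {ι : Type*} [Fintype ι] {G : 𝕜[X][X]} {a : 𝕜} {u : ι → 𝕜[X]}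
    {N r : ℕ} (h : HasApproxRoots G a u N) (hr : r ≠ 0) :
    HasApproxRoots (G.map (expand 𝕜 r : 𝕜[X] →+* 𝕜[X])) a (fun i => expand 𝕜 r (u i)) N := by
  have hmap := map_dvd (mapRingHom (expand 𝕜 r : 𝕜[X] →+* 𝕜[X])) h
  simp only [coe_mapRingHom, Polynomial.map_sub, Polynomial.map_mul, Polynomial.map_prod, map_C,
    map_X, RingHom.coe_coe, expand_C, map_pow, expand_X, ← pow_mul] at hmap
  refine (_root_.map_dvd C (pow_dvd_pow X ?_)).trans (by rwa [C_pow])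
  exact Nat.le_mul_of_pos_left N (Nat.pos_of_ne_zero hr)

theorem exists_hasApproxRoots [IsAlgClosed 𝕜] [CharZero 𝕜] {F : 𝕜[X][X]} {n : ℕ} (hF : F.Monic)
    (hn : F.natDegree = n) : ∃ s ≠ 0, ∀ N, ∃ u : Fin n → 𝕜[X],
      HasApproxRoots (F.map (expand 𝕜 s : 𝕜[X] →+* 𝕜[X])) 1 u N := by
  let φ : 𝕜[X] →+* PowerSeries 𝕜 := coeToPowerSeries.ringHom
  obtain ⟨s, hs, hsplit⟩ := splitsAfterRamification (hF.map φ)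
  have hcomm : (F.map φ).map (expandHom 𝕜 s hs) =
      (F.map (expand 𝕜 s : 𝕜[X] →+* 𝕜[X])).map φ := by
    rw [Polynomial.map_map, Polynomial.map_map]
    exact congrArg (fun ψ => F.map ψ) (RingHom.ext fun p => (coe_expand hs p).symm)
  obtain ⟨u, hu⟩ := exists_eq_prod_X_sub_C (n := n) ((hF.map φ).map (expandHom 𝕜 s hs))
    (by rw [(hF.map φ).natDegree_map, hF.natDegree_map, hn]) hsplit
  refine ⟨s, hs, fun N => ⟨fun i => PowerSeries.trunc N (u i), ?_⟩⟩
  have hdvd := C_dvd_prod_X_sub_C_sub_prod fun i => X_pow_dvd_sub_trunc (u i) N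
  rw [← hu, hcomm, C_dvd_iff_dvd_coeff] at hdvd
  rw [HasApproxRoots, C_1, C_1, one_mul, C_dvd_iff_dvd_coeff]
  intro i
  rw [← X_pow_dvd_coe_iff]
  convert hdvd i
  rw [← coeToPowerSeries.ringHom_apply, ← coeff_map, Polynomial.map_sub, Polynomial.map_prod]
  simp [φ]

end Puiseux

/-! ### Newton chains -/

namespace NewtonChain

open Puiseux

section Field

variable {𝕜 : Type*} [Field 𝕜]

theorem trailingCoeff_pow (p : 𝕜[X]) (n : ℕ) : (p ^ n).trailingCoeff = p.trailingCoeff ^ n := by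
  induction n with
  | zero => simp [trailingCoeff]
  | succ n ih => rw [pow_succ, pow_succ, trailingCoeff_mul, ih]

theorem natTrailingDegree_pow (p : 𝕜[X]) (n : ℕ) :
    (p ^ n).natTrailingDegree = n * p.natTrailingDegree := by
  rcases eq_or_ne p 0 with rfl | hp
  · rcases n with _ | n <;> simp
  induction n with
  | zero => simp
  | succ n ih => rw [pow_succ, natTrailingDegree_mul (pow_ne_zero n hp) hp, ih, Nat.succ_mul]

theorem X_pow_dvd_iff_le_natTrailingDegree {v : 𝕜[X]} (hv : v ≠ 0) {k : ℕ} :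
    X ^ k ∣ v ↔ k ≤ v.natTrailingDegree := by
  rw [X_pow_dvd_iff]
  exact ⟨le_natTrailingDegree hv,
    fun h i hi => coeff_eq_zero_of_lt_natTrailingDegree (hi.trans_le h)⟩

/-- One step along a Newton chain: the leading term of `p'` is the trailing term of `p`, except
that its exponent is carried over to the order `α'`. Here `t ^ α * p` and `t ^ α' * p'` are the
lowest terms of a polynomial in `t` and `t ^ k * ξ` and of the same polynomial in `t` and
`t ^ (k + 1) * ξ`. -/
structure IsNewtonStep (α : ℕ) (p : 𝕜[X]) (α' : ℕ) (p' : 𝕜[X]) : Prop where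
  ne_zero : p ≠ 0
  natDegree_eq : p'.natDegree = p.natTrailingDegree
  leadingCoeff_eq : p'.leadingCoeff = p.trailingCoeff
  order_eq : α' = α + p.natTrailingDegree

namespace IsNewtonStep

variable {α α' β β' : ℕ} {p p' q q' : 𝕜[X]}

theorem ne_zero_right (h : IsNewtonStep α p α' p') : p' ≠ 0 := by
  rw [← leadingCoeff_ne_zero, h.leadingCoeff_eq, Ne, trailingCoeff_eq_zero]
  exact h.ne_zero

theorem const {a : 𝕜} (ha : a ≠ 0) : IsNewtonStep 0 (C a) 0 (C a) :=
  ⟨C_ne_zero.2 ha, by simp, by simp [trailingCoeff], by simp⟩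

theorem mul (h : IsNewtonStep α p α' p') (h' : IsNewtonStep β q β' q') :
    IsNewtonStep (α + β) (p * q) (α' + β') (p' * q') where
  ne_zero := mul_ne_zero h.ne_zero h'.ne_zero
  natDegree_eq := by
    rw [natDegree_mul h.ne_zero_right h'.ne_zero_right, natTrailingDegree_mul h.ne_zero h'.ne_zero,
      h.natDegree_eq, h'.natDegree_eq]
  leadingCoeff_eq := by
    rw [leadingCoeff_mul, trailingCoeff_mul, h.leadingCoeff_eq, h'.leadingCoeff_eq]
  order_eq := by
    rw [natTrailingDegree_mul h.ne_zero h'.ne_zero, h.order_eq, h'.order_eq]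
    ring

theorem prod {ι : Type*} (s : Finset ι) {α α' : ι → ℕ} {p p' : ι → 𝕜[X]}
    (h : ∀ i, IsNewtonStep (α i) (p i) (α' i) (p' i)) :
    IsNewtonStep (∑ i ∈ s, α i) (∏ i ∈ s, p i) (∑ i ∈ s, α' i) (∏ i ∈ s, p' i) := by
  classical
  induction s using Finset.induction_on with
  | empty => simpa using const (one_ne_zero (α := 𝕜))
  | insert i s hi ih =>
    simpa only [Finset.sum_insert hi, Finset.prod_insert hi] using (h i).mul ih

end IsNewtonStep

/-- The minimum of `k` and the order of vanishing of `v` at `0`. -/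
noncomputable def truncOrder (k : ℕ) (v : 𝕜[X]) : ℕ :=
  open Classical in if X ^ k ∣ v then k else v.natTrailingDegree

/-- The value at `t = 0` of `(t ^ k * ξ + v(t)) / t ^ truncOrder k v`, as a polynomial in `ξ`. -/
noncomputable def residueFactor (k : ℕ) (v : 𝕜[X]) : 𝕜[X] :=
  open Classical in if X ^ k ∣ v then X + C (v.coeff k) else C v.trailingCoeff

variable {k : ℕ} {v : 𝕜[X]}

theorem truncOrder_of_dvd (h : X ^ k ∣ v) : truncOrder k v = k := if_pos h

theorem truncOrder_of_not_dvd (h : ¬ X ^ k ∣ v) : truncOrder k v = v.natTrailingDegree := if_neg h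

theorem residueFactor_of_dvd (h : X ^ k ∣ v) : residueFactor k v = X + C (v.coeff k) := if_pos h

theorem residueFactor_of_not_dvd (h : ¬ X ^ k ∣ v) : residueFactor k v = C v.trailingCoeff :=
  if_neg h

theorem truncOrder_zero (v : 𝕜[X]) : truncOrder 0 v = 0 := truncOrder_of_dvd (by simp)

theorem residueFactor_zero (v : 𝕜[X]) : residueFactor 0 v = X + C (v.coeff 0) :=
  residueFactor_of_dvd (by simp)

theorem natDegree_residueFactor_le_one (k : ℕ) (v : 𝕜[X]) : (residueFactor k v).natDegree ≤ 1 := by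
  by_cases h : X ^ k ∣ v
  · rw [residueFactor_of_dvd h, natDegree_X_add_C]
  · rw [residueFactor_of_not_dvd h, natDegree_C]
    exact zero_le_one

theorem isNewtonStep_residueFactor (k : ℕ) (v : 𝕜[X]) :
    IsNewtonStep (truncOrder k v) (residueFactor k v) (truncOrder (k + 1) v)
      (residueFactor (k + 1) v) := by
  have hX : IsNewtonStep k (X : 𝕜[X]) (k + 1) (X + C (v.coeff (k + 1))) :=
    ⟨X_ne_zero, by simp, by simp [trailingCoeff], by simp⟩
  rcases eq_or_ne v 0 with rfl | hv
  · simpa [truncOrder_of_dvd, residueFactor_of_dvd] using hX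
  have hdvd (k : ℕ) := X_pow_dvd_iff_le_natTrailingDegree hv (k := k)
  rcases lt_trichotomy k v.natTrailingDegree with hk | rfl | hk
  · have h := (hdvd k).2 hk.le
    have h' := (hdvd (k + 1)).2 hk
    rwa [truncOrder_of_dvd h, residueFactor_of_dvd h, truncOrder_of_dvd h',
      residueFactor_of_dvd h', coeff_eq_zero_of_lt_natTrailingDegree hk, C_0, add_zero]
  · have h := (hdvd v.natTrailingDegree).2 le_rfl
    have h' := (hdvd (v.natTrailingDegree + 1)).not.2 (Nat.not_succ_le_self _)
    rw [truncOrder_of_dvd h, residueFactor_of_dvd h, truncOrder_of_not_dvd h',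
      residueFactor_of_not_dvd h', ← trailingCoeff]
    have hc : v.trailingCoeff ≠ 0 := by rwa [Ne, trailingCoeff_eq_zero]
    have h0 : (X + C v.trailingCoeff).natTrailingDegree = 0 := by
      rw [natTrailingDegree_eq_zero]
      right
      simpa using hc
    exact ⟨X_add_C_ne_zero _, by rw [h0, natDegree_C],
      by rw [trailingCoeff.eq_1 (X + _), h0]; simp, by rw [h0, add_zero]⟩
  · have h := (hdvd k).not.2 hk.not_ge
    have h' := (hdvd (k + 1)).not.2 (by omega)
    rw [truncOrder_of_not_dvd h, residueFactor_of_not_dvd h, truncOrder_of_not_dvd h',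
      residueFactor_of_not_dvd h']
    simpa using (IsNewtonStep.const (by rwa [Ne, trailingCoeff_eq_zero])).mul
      (⟨one_ne_zero, by simp, by simp [trailingCoeff], by simp⟩ :
        IsNewtonStep v.natTrailingDegree (1 : 𝕜[X]) v.natTrailingDegree 1)

theorem exists_truncOrder_eq {S : ℕ} (hS : v ≠ 0 → S ∣ v.natTrailingDegree) (k : ℕ) :
    ∃ b, truncOrder k v = k * (residueFactor k v).natDegree + S * b := by
  by_cases h : X ^ k ∣ v
  · exact ⟨0, by rw [truncOrder_of_dvd h, residueFactor_of_dvd h, natDegree_X_add_C]; simp⟩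
  · obtain ⟨b, hb⟩ := hS (by rintro rfl; exact h (dvd_zero _))
    exact ⟨b, by rw [truncOrder_of_not_dvd h, residueFactor_of_not_dvd h, natDegree_C, hb]; simp⟩

/-- The order in `t` of `∏ i, (t ^ k * ξ + v i)`. -/
noncomputable def totalOrder {ι : Type*} [Fintype ι] (v : ι → 𝕜[X]) (k : ℕ) : ℕ :=
  ∑ i, truncOrder k (v i)

/-- The lowest order coefficient of `a * ∏ i, (t ^ k * ξ + v i)`, as a polynomial in `ξ`. -/
noncomputable def residuePoly {ι : Type*} [Fintype ι] (a : 𝕜) (v : ι → 𝕜[X]) (k : ℕ) : 𝕜[X] :=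
  C a * ∏ i, residueFactor k (v i)

/-- A sequence of polynomials with orders in which each step is a Newton step: the lowest terms of
one polynomial in `t` and `Y` after the substitutions `Y = t ^ k * ξ`, for `k = 0, 1, 2, …`. -/
def IsNewtonChain (α : ℕ → ℕ) (p : ℕ → 𝕜[X]) : Prop :=
  ∀ k, IsNewtonStep (α k) (p k) (α (k + 1)) (p (k + 1))

namespace IsNewtonChain

variable {α : ℕ → ℕ} {p : ℕ → 𝕜[X]}

theorem monotone (h : IsNewtonChain α p) : Monotone α :=
  monotone_nat_of_le_succ fun k => (h k).order_eq ▸ Nat.le_add_right _ _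

theorem antitone_natTrailingDegree (h : IsNewtonChain α p) :
    Antitone fun k => (p k).natTrailingDegree :=
  antitone_nat_of_succ_le fun k => (natTrailingDegree_le_natDegree _).trans (h k).natDegree_eq.le

theorem natTrailingDegree_ne_zero (h : IsNewtonChain α p) {k j : ℕ} (hkj : α k < α j) :
    (p k).natTrailingDegree ≠ 0 := by
  intro h0
  have hle : ∀ i, α (k + i) ≤ α k := fun i => by
    induction i with
    | zero => exact le_rfl
    | succ i ih =>
      have hi : (p (k + i)).natTrailingDegree = 0 :=
        Nat.eq_zero_of_le_zero (h0 ▸ h.antitone_natTrailingDegree (Nat.le_add_right k i))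
      rwa [← add_assoc, (h (k + i)).order_eq, hi, add_zero]
  obtain ⟨i, rfl⟩ := Nat.exists_eq_add_of_le (h.monotone.reflect_lt hkj).le
  exact (hle i).not_gt hkj

end IsNewtonChain

section Product

variable {ι : Type*} [Fintype ι] {a : 𝕜} (v : ι → 𝕜[X])

theorem totalOrder_zero : totalOrder v 0 = 0 := by
  simp only [totalOrder, truncOrder_zero, Finset.sum_const_zero]

theorem natDegree_residuePoly_zero (ha : a ≠ 0) :
    (residuePoly a v 0).natDegree = Fintype.card ι := by
  simp only [residuePoly, residueFactor_zero]
  rw [natDegree_C_mul ha, natDegree_prod _ _ fun i _ => X_add_C_ne_zero _]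
  simp

theorem leadingCoeff_residuePoly_zero : (residuePoly a v 0).leadingCoeff = a := by
  simp only [residuePoly, residueFactor_zero, leadingCoeff_mul, leadingCoeff_C, leadingCoeff_prod,
    leadingCoeff_X_add_C, Finset.prod_const_one, mul_one]

theorem isNewtonChain_residuePoly (ha : a ≠ 0) :
    IsNewtonChain (totalOrder v) (residuePoly a v) := fun k => by
  simpa only [zero_add, totalOrder, residuePoly] using (IsNewtonStep.const ha).mul
    (.prod Finset.univ fun i => isNewtonStep_residueFactor k (v i))

variable {v}

theorem natDegree_residuePoly (ha : a ≠ 0) (k : ℕ) :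
    (residuePoly a v k).natDegree = ∑ i, (residueFactor k (v i)).natDegree := by
  rw [residuePoly, natDegree_C_mul ha,
    natDegree_prod _ _ fun i _ => (isNewtonStep_residueFactor k (v i)).ne_zero]

theorem natDegree_residuePoly_le (ha : a ≠ 0) (k : ℕ) :
    (residuePoly a v k).natDegree ≤ Fintype.card ι := by
  rw [natDegree_residuePoly ha, Fintype.card_eq_sum_ones]
  exact Finset.sum_le_sum fun i _ => natDegree_residueFactor_le_one k (v i)

theorem exists_totalOrder_eq (ha : a ≠ 0) {S : ℕ}
    (hS : ∀ i, v i ≠ 0 → S ∣ (v i).natTrailingDegree) (k : ℕ) :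
    ∃ b, totalOrder v k = k * (residuePoly a v k).natDegree + S * b := by
  choose b hb using fun i => exists_truncOrder_eq (hS i) k
  refine ⟨∑ i, b i, ?_⟩
  rw [natDegree_residuePoly ha, totalOrder, Finset.mul_sum, Finset.mul_sum,
    ← Finset.sum_add_distrib]
  exact Finset.sum_congr rfl fun i _ => hb i

theorem mul_natDegree_le_totalOrder (ha : a ≠ 0) (k : ℕ) :
    k * (residuePoly a v k).natDegree ≤ totalOrder v k := by
  obtain ⟨b, hb⟩ := exists_totalOrder_eq (v := v) ha (S := 1) (fun _ _ => one_dvd _) k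
  exact hb ▸ Nat.le_add_right _ _

-- The order jumps by `μ = deg p (k + 1) ≤ card ι`, and `μ ∣ S` divides both `D` and the new order.
theorem totalOrder_succ_eq_of_dvd {S D k : ℕ} (hv : ∀ i, v i ≠ 0 → S ∣ (v i).natTrailingDegree)
    (hS : (Fintype.card ι).factorial ∣ S) (hD : S ∣ D) (hlt : totalOrder v k < D)
    (hle : D ≤ totalOrder v (k + 1)) : totalOrder v (k + 1) = D := by
  have h1 : (1 : 𝕜) ≠ 0 := one_ne_zero
  have hstep := isNewtonChain_residuePoly v h1 k
  have horder := hstep.order_eq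
  rw [← hstep.natDegree_eq] at horder
  obtain ⟨b, hb⟩ := exists_totalOrder_eq h1 hv (k + 1)
  set μ := (residuePoly 1 v (k + 1)).natDegree
  have hμS : μ ∣ S := (Nat.dvd_factorial (by omega) (natDegree_residuePoly_le h1 (k + 1))).trans hS
  have hμ : μ ∣ totalOrder v (k + 1) :=
    hb ▸ dvd_add (dvd_mul_left _ _) (hμS.trans (dvd_mul_right _ _))
  have h0 := Nat.eq_zero_of_dvd_of_lt (Nat.dvd_sub hμ (hμS.trans hD)) (by omega)
  omega

end Product

/-- `G(t, t ^ k * ξ + w(t)) = t ^ α * (p(ξ) + O(t))`, where `𝕜[X][X]` is read as `𝕜[t][Y]`. -/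
def HasLeadingForm (G : 𝕜[X][X]) (w : 𝕜[X]) (k α : ℕ) (p : 𝕜[X]) : Prop :=
  ∃ g : 𝕜[X][X], G.comp (C (X ^ k) * X + C w) = C (X ^ α) * g ∧ g.map (evalRingHom 0) = p

namespace HasLeadingForm

variable {G H : 𝕜[X][X]} {w : 𝕜[X]} {k α β : ℕ} {p q : 𝕜[X]}

theorem const (a : 𝕜) (w : 𝕜[X]) (k : ℕ) : HasLeadingForm (C (C a)) w k 0 (C a) :=
  ⟨C (C a), by simp, by simp⟩

theorem mul (hG : HasLeadingForm G w k α p) (hH : HasLeadingForm H w k β q) :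
    HasLeadingForm (G * H) w k (α + β) (p * q) := by
  obtain ⟨g, hg, rfl⟩ := hG
  obtain ⟨h, hh, rfl⟩ := hH
  refine ⟨g * h, ?_, Polynomial.map_mul _⟩
  rw [mul_comp, hg, hh, pow_add, C_mul]
  ring

theorem prod {ι : Type*} (s : Finset ι) {G : ι → 𝕜[X][X]} {α : ι → ℕ} {p : ι → 𝕜[X]}
    (h : ∀ i, HasLeadingForm (G i) w k (α i) (p i)) :
    HasLeadingForm (∏ i ∈ s, G i) w k (∑ i ∈ s, α i) (∏ i ∈ s, p i) := by
  classical
  induction s using Finset.induction_on with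
  | empty => simpa using const (1 : 𝕜) w k
  | insert i s hi ih =>
    simpa only [Finset.sum_insert hi, Finset.prod_insert hi] using (h i).mul ih

theorem add_C_X_pow_mul (hG : HasLeadingForm G w k α p) {N : ℕ} (hN : α < N) (R : 𝕜[X][X]) :
    HasLeadingForm (G + C (X ^ N) * R) w k α p := by
  obtain ⟨g, hg, rfl⟩ := hG
  refine ⟨g + C (X ^ (N - α)) * R.comp (C (X ^ k) * X + C w), ?_, ?_⟩
  · rw [add_comp, hg, mul_comp, C_comp, mul_add, ← mul_assoc, ← C_mul, ← pow_add,
      Nat.add_sub_cancel' hN.le]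
  · simp [Nat.sub_ne_zero_of_lt hN]

theorem X_sub_C (u w : 𝕜[X]) (k : ℕ) :
    HasLeadingForm (X - C u) w k (truncOrder k (w - u)) (residueFactor k (w - u)) := by
  have hcomp : (X - C u).comp (C (X ^ k) * X + C w) = C (X ^ k) * X + C (w - u) := by
    simp only [sub_comp, X_comp, C_comp, C_sub]
    ring
  by_cases h : X ^ k ∣ w - u
  · rw [truncOrder_of_dvd h, residueFactor_of_dvd h]
    obtain ⟨b, hb⟩ := h
    have hb0 : (w - u).coeff k = b.eval 0 := by
      rw [hb, coeff_X_pow_mul', if_pos le_rfl, Nat.sub_self, coeff_zero_eq_eval_zero]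
    exact ⟨X + C b, by rw [hcomp, hb, mul_add, C_mul], by simp [hb0]⟩
  · have hne : w - u ≠ 0 := fun h0 => h (h0 ▸ dvd_zero _)
    have hlt := not_le.1 ((X_pow_dvd_iff_le_natTrailingDegree hne).not.1 h)
    obtain ⟨b, hb⟩ := (X_pow_dvd_iff_le_natTrailingDegree hne).2 le_rfl
    rw [truncOrder_of_not_dvd h, residueFactor_of_not_dvd h, trailingCoeff]
    set r := (w - u).natTrailingDegree
    have hb0 : (w - u).coeff r = b.eval 0 := by
      rw [hb, coeff_X_pow_mul', if_pos le_rfl, Nat.sub_self, coeff_zero_eq_eval_zero]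
    refine ⟨C (X ^ (k - r)) * X + C b, ?_, by simp [hb0, Nat.sub_ne_zero_of_lt hlt]⟩
    rw [hcomp, hb, mul_add, ← mul_assoc, ← C_mul, ← C_mul, ← pow_add,
      Nat.add_sub_cancel' hlt.le]

theorem of_hasApproxRoots {ι : Type*} [Fintype ι] {a : 𝕜} {u : ι → 𝕜[X]} {N : ℕ}
    (h : HasApproxRoots G a u N) (hN : totalOrder (fun i => w - u i) k < N) :
    HasLeadingForm G w k (totalOrder (fun i => w - u i) k)
      (residuePoly a (fun i => w - u i) k) := by
  obtain ⟨R, hR⟩ := h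
  rw [eq_add_of_sub_eq' hR]
  refine add_C_X_pow_mul ?_ hN R
  simpa only [zero_add, totalOrder, residuePoly] using
    (const a w k).mul (.prod Finset.univ fun i => X_sub_C (u i) w k)

end HasLeadingForm

end Field

section Proportional

theorem wronskian_pow_succ {R : Type*} [CommRing R] (p q : R[X]) (d e : ℕ) :
    wronskian (p ^ (e + 1)) (q ^ (d + 1)) =
      p ^ e * q ^ d * (C (d + 1 : R) * p * derivative q - C (e + 1 : R) * q * derivative p) := by
  rw [wronskian, derivative_pow_succ, derivative_pow_succ]
  ring

variable {𝕜 : Type*} [Field 𝕜] {A B : 𝕜} {d e K L : ℕ}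

/-- The orders and degrees of `t ^ α * p` and `t ^ β * q` are in the ratio `d : e`, and the leading
coefficients of `p ^ e` and `q ^ d` are in the ratio `A ^ e : B ^ d`. This is the invariant
propagated along the Newton chains of a Jacobian pair. -/
structure IsProportional (A B : 𝕜) (d e M α : ℕ) (p : 𝕜[X]) (β : ℕ) (q : 𝕜[X]) : Prop where
  order_eq : e * α = d * β
  natDegree_left : p.natDegree = d * M
  natDegree_right : q.natDegree = e * M
  leadingCoeff_eq : B ^ d * p.leadingCoeff ^ e = A ^ e * q.leadingCoeff ^ d

/-- The weighted Wronskian of `t ^ (α - D) * p` and `t ^ (β - E) * q` is constant. It is what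
remains of the Jacobian condition in the lowest order terms of a Jacobian pair. -/
def HasConstWronskian (D E α : ℕ) (p : 𝕜[X]) (β : ℕ) (q : 𝕜[X]) : Prop :=
  ∃ c : 𝕜, C ((D : 𝕜) - α) * p * derivative q - C ((E : 𝕜) - β) * q * derivative p = C c

theorem mul_derivative_eq_of_sub_eq_C {p q : 𝕜[X]} {a b c : 𝕜} (ha : a ≠ 0)
    (hab : (d : 𝕜) * b = e * a) (hp : p.coeff 0 = 0) (hq : q.coeff 0 = 0)
    (h : C a * p * derivative q - C b * q * derivative p = C c) :
    C (d : 𝕜) * p * derivative q = C (e : 𝕜) * q * derivative p := by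
  have hc : c = 0 := by simpa [mul_coeff_zero, hp, hq] using (congrArg (coeff · 0) h).symm
  rw [hc, C_0] at h
  refine mul_left_cancel₀ (C_ne_zero.2 ha) ?_
  have hab' := congrArg C hab
  rw [C_mul, C_mul] at hab'
  linear_combination C (d : 𝕜) * h + q * derivative p * hab'

variable [CharZero 𝕜]

theorem C_leadingCoeff_mul_eq_of_wronskian_eq_zero {u w : 𝕜[X]} (h : wronskian u w = 0) :
    C w.leadingCoeff * u = C u.leadingCoeff * w := by
  classical
  rcases eq_or_ne w 0 with rfl | hw
  · simp
  obtain ⟨u', hu⟩ := EuclideanDomain.gcd_dvd_left u w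
  obtain ⟨w', hw'⟩ := EuclideanDomain.gcd_dvd_right u w
  have hg : EuclideanDomain.gcd u w ≠ 0 := fun h0 => hw (EuclideanDomain.gcd_eq_zero_iff.1 h0).2
  have hcop : IsCoprime u' w' := by
    have h' := EuclideanDomain.gcd_eq_gcd_ab u w
    refine ⟨EuclideanDomain.gcdA u w, EuclideanDomain.gcdB u w, mul_left_cancel₀ hg ?_⟩
    linear_combination -h' - EuclideanDomain.gcdA u w * hu - EuclideanDomain.gcdB u w * hw'
  set g := EuclideanDomain.gcd u w
  have hW : g ^ 2 * wronskian u' w' = 0 := by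
    rw [← h, hu, hw', wronskian, wronskian, derivative_mul, derivative_mul]
    ring
  obtain ⟨hu0, hw0⟩ := hcop.wronskian_eq_zero_iff.1
    ((mul_eq_zero.1 hW).resolve_left (pow_ne_zero 2 hg))
  obtain ⟨a, rfl⟩ := natDegree_eq_zero.1 (derivative_eq_zero.1 hu0)
  obtain ⟨b, rfl⟩ := natDegree_eq_zero.1 (derivative_eq_zero.1 hw0)
  rw [hu, hw', leadingCoeff_mul, leadingCoeff_mul, leadingCoeff_C, leadingCoeff_C, C_mul, C_mul]
  ring

theorem C_leadingCoeff_pow_mul_pow_eq {p q : 𝕜[X]} {d e : ℕ} (hd : d ≠ 0) (he : e ≠ 0)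
    (h : C (d : 𝕜) * p * derivative q = C (e : 𝕜) * q * derivative p) :
    C (q.leadingCoeff ^ d) * p ^ e = C (p.leadingCoeff ^ e) * q ^ d := by
  obtain ⟨d, rfl⟩ := Nat.exists_eq_succ_of_ne_zero hd
  obtain ⟨e, rfl⟩ := Nat.exists_eq_succ_of_ne_zero he
  rw [← leadingCoeff_pow, ← leadingCoeff_pow]
  refine C_leadingCoeff_mul_eq_of_wronskian_eq_zero ?_
  push_cast at h
  rw [Nat.succ_eq_add_one, Nat.succ_eq_add_one, wronskian_pow_succ, h, sub_self, mul_zero]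

theorem exists_mul_of_coprime {d e a b : ℕ} (hde : Nat.Coprime d e) (hd : d ≠ 0)
    (h : e * a = d * b) : ∃ M, a = d * M ∧ b = e * M := by
  obtain ⟨M, rfl⟩ : d ∣ a := hde.dvd_of_dvd_mul_left ⟨b, h⟩
  exact ⟨M, rfl, mul_left_cancel₀ hd (by linarith)⟩

theorem IsProportional.step {α α' β β' M : ℕ} {p p' q q' : 𝕜[X]}
    (h : IsProportional A B d e M α p β q) (hde : Nat.Coprime d e) (hd : d ≠ 0) (he : e ≠ 0)
    (hp : IsNewtonStep α p α' p') (hq : IsNewtonStep β q β' q')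
    (hW : C (d : 𝕜) * p * derivative q = C (e : 𝕜) * q * derivative p) :
    ∃ M', IsProportional A B d e M' α' p' β' q' := by
  have hpow := C_leadingCoeff_pow_mul_pow_eq hd he hW
  have hlq : q.leadingCoeff ^ d ≠ 0 := pow_ne_zero _ (leadingCoeff_ne_zero.2 hq.ne_zero)
  have hlp : p.leadingCoeff ^ e ≠ 0 := pow_ne_zero _ (leadingCoeff_ne_zero.2 hp.ne_zero)
  have hdeg : e * p.natTrailingDegree = d * q.natTrailingDegree := by
    have := congrArg natTrailingDegree hpow
    rwa [natTrailingDegree_mul (C_ne_zero.2 hlq) (pow_ne_zero _ hp.ne_zero),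
      natTrailingDegree_mul (C_ne_zero.2 hlp) (pow_ne_zero _ hq.ne_zero), natTrailingDegree_C,
      natTrailingDegree_C, zero_add, zero_add, natTrailingDegree_pow, natTrailingDegree_pow] at this
  have hcoeff : q.leadingCoeff ^ d * p.trailingCoeff ^ e =
      p.leadingCoeff ^ e * q.trailingCoeff ^ d := by
    have htc (c : 𝕜) : (C c).trailingCoeff = c := by simp [trailingCoeff]
    simpa only [trailingCoeff_mul, htc, trailingCoeff_pow] using congrArg trailingCoeff hpow
  obtain ⟨M', hpM, hqM⟩ := exists_mul_of_coprime hde hd hdeg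
  refine ⟨M', ?_, hp.natDegree_eq.trans hpM, hq.natDegree_eq.trans hqM, ?_⟩
  · rw [hp.order_eq, hq.order_eq, mul_add, mul_add, h.order_eq, hdeg]
  · rw [hp.leadingCoeff_eq, hq.leadingCoeff_eq]
    refine mul_left_cancel₀ hlq ?_
    linear_combination B ^ d * hcoeff + q.trailingCoeff ^ d * h.leadingCoeff_eq

variable {α β : ℕ → ℕ} {p q : ℕ → 𝕜[X]}

theorem IsNewtonChain.exists_isProportional (hde : Nat.Coprime d e) (hd : d ≠ 0) (he : e ≠ 0)
    (hp : IsNewtonChain α p) (hq : IsNewtonChain β q)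
    (h0 : IsProportional A B d e K (α 0) (p 0) (β 0) (q 0))
    (hW : ∀ k, α k < d * L → β k < e * L →
      HasConstWronskian (d * L) (e * L) (α k) (p k) (β k) (q k))
    (hα : ∃ j, d * L ≤ α j) (hβ : ∃ j, e * L ≤ β j) (k : ℕ) (hk : ∀ i < k, α i < d * L) :
    ∃ M, IsProportional A B d e M (α k) (p k) (β k) (q k) := by
  obtain ⟨i, hi⟩ := hα
  obtain ⟨j, hj⟩ := hβ
  induction k with
  | zero => exact ⟨K, h0⟩
  | succ k ih =>
    obtain ⟨M, hM⟩ := ih fun i hi => hk i (by omega)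
    have hαk : α k < d * L := hk k k.lt_succ_self
    have hβk : β k < e * L := by
      refine Nat.lt_of_mul_lt_mul_left (a := d) ?_
      rw [← hM.order_eq, mul_left_comm]
      exact Nat.mul_lt_mul_of_pos_left hαk (Nat.pos_of_ne_zero he)
    obtain ⟨c, hc⟩ := hW k hαk hβk
    refine hM.step hde hd he (hp k) (hq k) (mul_derivative_eq_of_sub_eq_C ?_ ?_
      (Polynomial.natTrailingDegree_ne_zero.1 (hp.natTrailingDegree_ne_zero (hαk.trans_le hi))).2
      (Polynomial.natTrailingDegree_ne_zero.1 (hq.natTrailingDegree_ne_zero (hβk.trans_le hj))).2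
      hc)
    · rw [sub_ne_zero]
      exact_mod_cast hαk.ne'
    · have horder : (e : 𝕜) * α k = d * β k := by exact_mod_cast hM.order_eq
      push_cast
      linear_combination horder

theorem IsNewtonChain.exists_dicritical (hde : Nat.Coprime d e) (hd : d ≠ 0) (he : e ≠ 0)
    (hp : IsNewtonChain α p) (hq : IsNewtonChain β q)
    (h0 : IsProportional A B d e K (α 0) (p 0) (β 0) (q 0))
    (hW : ∀ k, α k < d * L → β k < e * L →
      HasConstWronskian (d * L) (e * L) (α k) (p k) (β k) (q k))
    (hα0 : α 0 < d * L) (hα : ∃ j, d * L ≤ α j) (hβ : ∃ j, e * L ≤ β j)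
    (hhit : ∀ k, α k < d * L → d * L ≤ α (k + 1) → α (k + 1) = d * L) :
    ∃ k, ∃ M ≠ 0, α k = d * L ∧ β k = e * L ∧
      IsProportional A B d e M (α k) (p k) (β k) (q k) := by
  classical
  obtain ⟨k, hk⟩ : ∃ k, Nat.find hα = k + 1 :=
    Nat.exists_eq_succ_of_ne_zero fun h => ((Nat.find_eq_zero hα).1 h).not_gt hα0
  have hlt : ∀ i < k + 1, α i < d * L := fun i hi => not_le.1 (Nat.find_min hα (hk ▸ hi))
  have hαk : α (k + 1) = d * L := hhit k (hlt k k.lt_succ_self) (hk ▸ Nat.find_spec hα)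
  obtain ⟨M, hM⟩ := hp.exists_isProportional hde hd he hq h0 hW hα hβ (k + 1) hlt
  refine ⟨k + 1, M, ?_, hαk, mul_left_cancel₀ hd ?_, hM⟩
  · rintro rfl
    have hdeg := (hp k).natDegree_eq.symm.trans hM.natDegree_left
    have := hlt k k.lt_succ_self
    have := (hp k).order_eq
    omega
  · rw [← hM.order_eq, hαk, mul_left_comm]

end Proportional

end NewtonChain

namespace PlanePoly

/-! ### The Jacobian condition at infinity -/

section EulerDerivation

variable {R : Type*} [CommRing R]

/-- The derivation `t ∂/∂t` of `R[t][Y]`, where `t` is the inner variable. -/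
noncomputable def eulerDeriv : Derivation R R[X][X] R[X][X] :=
  LinearMap.compDer (PolynomialModule.equivPolynomialSelf (R := R[X])).toLinearMap
    ((X : R[X]) • derivative' (R := R)).mapCoeffs

theorem coeff_eulerDeriv (F : R[X][X]) (i : ℕ) :
    (eulerDeriv F).coeff i = X * derivative (F.coeff i) := rfl

theorem eulerDeriv_C (a : R[X]) : eulerDeriv (C a) = C (X * derivative a) := by
  ext1 i
  rw [coeff_eulerDeriv, coeff_C, coeff_C]
  split_ifs <;> simp

theorem eulerDeriv_X_pow (n : ℕ) : eulerDeriv (X ^ n : R[X][X]) = 0 := by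
  ext1 i
  rw [coeff_eulerDeriv, coeff_X_pow]
  split_ifs <;> simp

theorem eulerDeriv_C_X_pow (n : ℕ) :
    eulerDeriv (C (X ^ n) : R[X][X]) = (n : R[X][X]) * C (X ^ n) := by
  rw [eulerDeriv_C, ← C_eq_natCast, ← C_mul, derivative_X_pow, map_natCast]
  cases n with
  | zero => simp
  | succ n => rw [Nat.add_sub_cancel, pow_succ, mul_left_comm, mul_comm X]

theorem eulerDeriv_comp (F q : R[X][X]) :
    eulerDeriv (F.comp q) = (eulerDeriv F).comp q + (derivative F).comp q * eulerDeriv q := by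
  induction F using Polynomial.induction_on' with
  | add F G hF hG =>
    simp only [add_comp, map_add, hF, hG]
    ring
  | monomial n a =>
    rw [← C_mul_X_pow_eq_monomial, Derivation.leibniz, eulerDeriv_X_pow, eulerDeriv_C,
      derivative_C_mul_X_pow]
    simp only [mul_comp, C_comp, X_pow_comp, Derivation.leibniz, Derivation.leibniz_pow,
      eulerDeriv_C, smul_eq_mul, nsmul_eq_mul, mul_zero, zero_add, C_mul, map_natCast,
      natCast_comp]
    ring

theorem eulerDeriv_map_expand (m : ℕ) (F : R[X][X]) :
    eulerDeriv (F.map (expand R m : R[X] →+* R[X])) =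
      (m : R[X][X]) * (eulerDeriv F).map (expand R m : R[X] →+* R[X]) := by
  ext1 i
  rw [coeff_eulerDeriv, coeff_map, ← C_eq_natCast, coeff_C_mul, coeff_map, coeff_eulerDeriv]
  simp only [RingHom.coe_coe, derivative_expand, map_mul, expand_X]
  cases m with
  | zero => simp
  | succ m =>
    rw [Nat.add_sub_cancel, pow_succ]
    ring

theorem map_evalRingHom_zero_eulerDeriv (F : R[X][X]) :
    (eulerDeriv F).map (evalRingHom 0) = 0 := by
  ext1 i
  rw [coeff_map, coeff_eulerDeriv]
  simp

/-- The Wronskian of `t ^ (-N) * G` and `t ^ (-N') * H` with respect to `t ∂/∂t` and `∂/∂Y`,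
multiplied by `t ^ (N + N')` in order to stay in `R[t][Y]`. -/
noncomputable def weightedWronskian (N N' : R) (G H : R[X][X]) : R[X][X] :=
  (eulerDeriv G - C (C N) * G) * derivative H - (eulerDeriv H - C (C N') * H) * derivative G

theorem weightedWronskian_map_expand (m : ℕ) (N N' : R) (G H : R[X][X]) :
    weightedWronskian (m * N) (m * N') (G.map (expand R m : R[X] →+* R[X]))
      (H.map (expand R m : R[X] →+* R[X])) =
    (m : R[X][X]) * (weightedWronskian N N' G H).map (expand R m : R[X] →+* R[X]) := by
  simp only [weightedWronskian, eulerDeriv_map_expand, Polynomial.map_sub, Polynomial.map_mul,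
    derivative_map, map_C, RingHom.coe_coe, expand_C, C_mul, map_natCast]
  ring

theorem weightedWronskian_comp (N N' : R) (G H : R[X][X]) (w : R[X]) (k : ℕ) :
    weightedWronskian N N' (G.comp (C (X ^ k) * X + C w)) (H.comp (C (X ^ k) * X + C w)) =
      C (X ^ k) * (weightedWronskian N N' G H).comp (C (X ^ k) * X + C w) := by
  simp only [weightedWronskian, eulerDeriv_comp, derivative_comp, sub_comp, mul_comp, C_comp,
    derivative_add, derivative_C_mul, derivative_X, derivative_C]
  ring

theorem weightedWronskian_C_X_pow_mul (N N' : R) (a b : ℕ) (G H : R[X][X]) :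
    weightedWronskian N N' (C (X ^ a) * G) (C (X ^ b) * H) =
      C (X ^ (a + b)) * weightedWronskian (N - a) (N' - b) G H := by
  simp only [weightedWronskian, Derivation.leibniz, eulerDeriv_C_X_pow, derivative_C_mul, pow_add,
    C_mul, C_sub, smul_eq_mul, map_natCast]
  ring

theorem map_evalRingHom_zero_weightedWronskian (N N' : R) (G H : R[X][X]) :
    (weightedWronskian N N' G H).map (evalRingHom 0) =
      C N' * H.map (evalRingHom 0) * derivative (G.map (evalRingHom 0)) -
        C N * G.map (evalRingHom 0) * derivative (H.map (evalRingHom 0)) := by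
  simp only [weightedWronskian, Polynomial.map_sub, Polynomial.map_mul,
    map_evalRingHom_zero_eulerDeriv, map_C, coe_evalRingHom, eval_C, derivative_map]
  ring

end EulerDerivation

section LeadingForm

open NewtonChain Puiseux

variable {𝕜 : Type*} [Field 𝕜] {G H : 𝕜[X][X]} {w : 𝕜[X]}

theorem hasConstWronskian_of_hasLeadingForm {D E k α β : ℕ} {p q r : 𝕜[X]}
    (hG : HasLeadingForm G w k α p) (hH : HasLeadingForm H w k β q)
    (hr : weightedWronskian (D : 𝕜) E G H = C r) : HasConstWronskian D E α p β q := by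
  obtain ⟨g, hg, rfl⟩ := hG
  obtain ⟨h, hh, rfl⟩ := hH
  have hgh : C (X ^ (α + β)) * weightedWronskian ((D : 𝕜) - α) (E - β) g h = C (X ^ k * r) := by
    rw [← weightedWronskian_C_X_pow_mul, ← hg, ← hh, weightedWronskian_comp, hr, C_comp, C_mul]
  obtain ⟨c, hc⟩ : ∃ c, weightedWronskian ((D : 𝕜) - α) (E - β) g h = C c := by
    refine ⟨_, eq_C_of_natDegree_eq_zero (Nat.eq_zero_of_le_zero ?_)⟩
    refine natDegree_le_iff_coeff_eq_zero.2 fun i hi => ?_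
    have hi' := congrArg (coeff · i) hgh
    rw [coeff_C_mul, coeff_C_of_ne_zero hi.ne'] at hi'
    exact (mul_eq_zero.1 hi').resolve_left (pow_ne_zero _ X_ne_zero)
  refine ⟨-c.eval 0, ?_⟩
  rw [C_neg, ← coe_evalRingHom, ← map_C, ← hc, map_evalRingHom_zero_weightedWronskian, neg_sub]

variable {ι κ : Type*} [Fintype ι] [Fintype κ] {A B : 𝕜} {d e K L S N : ℕ}
  {u : ι → 𝕜[X]} {v : κ → 𝕜[X]} {r : 𝕜[X]}

theorem isProportional_residuePoly_zero (hA : A ≠ 0) (hB : B ≠ 0) (hι : Fintype.card ι = d * K)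
    (hκ : Fintype.card κ = e * K) (u : ι → 𝕜[X]) (v : κ → 𝕜[X]) :
    IsProportional A B d e K (totalOrder u 0) (residuePoly A u 0) (totalOrder v 0)
      (residuePoly B v 0) where
  order_eq := by rw [totalOrder_zero, totalOrder_zero, mul_zero, mul_zero]
  natDegree_left := by rw [natDegree_residuePoly_zero u hA, hι]
  natDegree_right := by rw [natDegree_residuePoly_zero v hB, hκ]
  leadingCoeff_eq := by
    rw [leadingCoeff_residuePoly_zero, leadingCoeff_residuePoly_zero, mul_comm]

theorem exists_isProportional_residuePoly [CharZero 𝕜] (hde : Nat.Coprime d e) (hd : d ≠ 0)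
    (he : e ≠ 0) (hL : L ≠ 0) (hA : A ≠ 0) (hB : B ≠ 0) (hι : Fintype.card ι = d * K)
    (hκ : Fintype.card κ = e * K) (hu : HasApproxRoots G A u N) (hv : HasApproxRoots H B v N)
    (hNd : d * L < N) (hNe : e * L < N)
    (hr : weightedWronskian ((d * L : ℕ) : 𝕜) ((e * L : ℕ) : 𝕜) G H = C r)
    (hS : ∀ i, w - u i ≠ 0 → S ∣ (w - u i).natTrailingDegree)
    (hιS : (Fintype.card ι).factorial ∣ S) (hSL : S ∣ L)
    (hα : ∃ k, d * L ≤ totalOrder (fun i => w - u i) k)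
    (hβ : ∃ k, e * L ≤ totalOrder (fun i => w - v i) k) :
    ∃ k, ∃ M ≠ 0, totalOrder (fun i => w - u i) k = d * L ∧
      totalOrder (fun i => w - v i) k = e * L ∧
      IsProportional A B d e M (d * L) (residuePoly A (fun i => w - u i) k) (e * L)
        (residuePoly B (fun i => w - v i) k) := by
  obtain ⟨k, M, hM, hk, hk', hprop⟩ := (isNewtonChain_residuePoly _ hA).exists_dicritical hde hd he
    (isNewtonChain_residuePoly _ hB)
    (isProportional_residuePoly_zero hA hB hι hκ (fun i => w - u i) fun i => w - v i)
    (fun k hk hk' => hasConstWronskian_of_hasLeadingForm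
      (.of_hasApproxRoots hu (hk.trans hNd)) (.of_hasApproxRoots hv (hk'.trans hNe)) hr)
    (by rw [totalOrder_zero]; exact Nat.pos_of_ne_zero (mul_ne_zero hd hL)) hα hβ
    fun k hk hk' => totalOrder_succ_eq_of_dvd hS hιS (hSL.mul_left d) hk hk'
  rw [hk, hk'] at hprop
  exact ⟨k, M, hM, hk, hk', hprop⟩

end LeadingForm

section Dehomogenize

variable {R : Type*} [CommRing R]

/-- The polynomial `t ^ n * P (1 / t, Y / t)` in `t` (the inner variable) and `Y`. It represents `P`
near the line at infinity when the total degree of `P` is at most `n`; subtraction of exponents is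
truncated, so the monomials of higher degree are not given their true order in `t`. -/
noncomputable def dehomogenize (n : ℕ) : MvPolynomial (Fin 2) R →ₗ[R] R[X][X] :=
  (MvPolynomial.basisMonomials (Fin 2) R).constr R fun s => C (X ^ (n - s 0 - s 1)) * X ^ s 1

theorem dehomogenize_monomial (n : ℕ) (s : Fin 2 →₀ ℕ) (a : R) :
    dehomogenize n (MvPolynomial.monomial s a) = C (C a * X ^ (n - s 0 - s 1)) * X ^ s 1 := by
  have hs : MvPolynomial.monomial s a = a • MvPolynomial.basisMonomials (Fin 2) R s := by
    rw [MvPolynomial.coe_basisMonomials, MvPolynomial.smul_monomial, smul_eq_mul, mul_one]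
  rw [hs, map_smul, dehomogenize, Module.Basis.constr_basis, ← algebraMap_smul R[X] a,
    algebraMap_eq, smul_eq_C_mul, C_mul, mul_assoc]

theorem induction_on_totalDegree_le {motive : MvPolynomial (Fin 2) R → Prop} {n : ℕ}
    {P : MvPolynomial (Fin 2) R} (hP : P.totalDegree ≤ n) (zero : motive 0)
    (add : ∀ F G, motive F → motive G → motive (F + G))
    (monomial : ∀ s a, s 0 + s 1 ≤ n → motive (MvPolynomial.monomial s a)) : motive P := by
  rw [P.as_sum]
  refine Finset.sum_induction _ motive add zero fun s hs => monomial s _ ?_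
  have hsn := (MvPolynomial.le_totalDegree hs).trans hP
  rwa [Finsupp.sum_fintype _ _ fun _ => rfl, Fin.sum_univ_two] at hsn

theorem totalDegree_pderiv_le {σ : Type*} (i : σ) (P : MvPolynomial σ R) :
    (MvPolynomial.pderiv i P).totalDegree ≤ P.totalDegree - 1 := by
  classical
  refine Finset.sup_le fun s hs => Nat.le_sub_one_of_lt ?_
  have hsP : s + Finsupp.single i 1 ∈ P.support := by
    rw [MvPolynomial.mem_support_iff, MvPolynomial.coeff_pderiv] at hs
    exact MvPolynomial.mem_support_iff.2 (left_ne_zero_of_mul hs)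
  have hsum := MvPolynomial.le_totalDegree hsP
  rwa [Finsupp.sum_add_index' (fun _ => rfl) fun _ _ _ => rfl, Finsupp.sum_single_index rfl] at hsum

theorem dehomogenize_mul {n n' : ℕ} {P Q : MvPolynomial (Fin 2) R} (hP : P.totalDegree ≤ n)
    (hQ : Q.totalDegree ≤ n') :
    dehomogenize (n + n') (P * Q) = dehomogenize n P * dehomogenize n' Q := by
  refine induction_on_totalDegree_le
    (motive := fun P => dehomogenize (n + n') (P * Q) = dehomogenize n P * dehomogenize n' Q)
    hP (by simp) (fun F G hF hG => by rw [add_mul, map_add, map_add, add_mul, hF, hG])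
    fun s a hs => ?_
  refine induction_on_totalDegree_le
    (motive := fun Q => dehomogenize (n + n') (_ * Q) = dehomogenize n _ * dehomogenize n' Q)
    hQ (by simp) (fun F G hF hG => by rw [mul_add, map_add, map_add, mul_add, hF, hG])
    fun s' a' hs' => ?_
  have hexp : n + n' - (s 0 + s' 0) - (s 1 + s' 1) = (n - s 0 - s 1) + (n' - s' 0 - s' 1) := by
    omega
  rw [MvPolynomial.monomial_mul, dehomogenize_monomial, dehomogenize_monomial,
    dehomogenize_monomial, Finsupp.add_apply, Finsupp.add_apply, hexp]
  simp only [C_mul, pow_add]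
  ring

theorem dehomogenize_pderiv_zero_monomial (n : ℕ) (s : Fin 2 →₀ ℕ) (a : R) :
    dehomogenize (n - 1) (MvPolynomial.pderiv 0 (MvPolynomial.monomial s a)) =
      (s 0 : R[X][X]) * dehomogenize n (MvPolynomial.monomial s a) := by
  rw [MvPolynomial.pderiv_monomial, dehomogenize_monomial, dehomogenize_monomial]
  rcases Nat.eq_zero_or_pos (s 0) with h0 | h0
  · simp [h0]
  · have hexp : n - 1 - (s 0 - 1) - s 1 = n - s 0 - s 1 := by omega
    simp [hexp]
    ring

theorem derivative_dehomogenize (n : ℕ) (P : MvPolynomial (Fin 2) R) :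
    derivative (dehomogenize n P) = dehomogenize (n - 1) (MvPolynomial.pderiv 1 P) := by
  induction P using MvPolynomial.induction_on' with
  | add P Q hP hQ => simp only [map_add, hP, hQ]
  | monomial s a =>
    rw [MvPolynomial.pderiv_monomial, dehomogenize_monomial, dehomogenize_monomial,
      derivative_C_mul_X_pow]
    rcases Nat.eq_zero_or_pos (s 1) with h1 | h1
    · simp [h1]
    · have hexp : n - 1 - s 0 - (s 1 - 1) = n - s 0 - s 1 := by omega
      simp [hexp]
      ring

theorem eulerDeriv_dehomogenize {n : ℕ} {P : MvPolynomial (Fin 2) R} (hP : P.totalDegree ≤ n) :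
    eulerDeriv (dehomogenize n P) = (n : R[X][X]) * dehomogenize n P -
      dehomogenize (n - 1) (MvPolynomial.pderiv 0 P) - X * derivative (dehomogenize n P) := by
  refine induction_on_totalDegree_le (motive := fun P => eulerDeriv (dehomogenize n P) =
      (n : R[X][X]) * dehomogenize n P - dehomogenize (n - 1) (MvPolynomial.pderiv 0 P) -
        X * derivative (dehomogenize n P))
    hP (by simp) (fun F G hF hG => by simp only [map_add, hF, hG]; ring) fun s a hs => ?_
  have hn : (n : R[X][X]) = ((n - s 0 - s 1 : ℕ) : R[X][X]) + s 0 + s 1 := by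
    rw [← Nat.cast_add, ← Nat.cast_add, Nat.sub_sub, add_assoc, Nat.sub_add_cancel hs]
  have hY : X * derivative (X ^ s 1 : R[X][X]) = (s 1 : R[X][X]) * X ^ s 1 := by
    cases s 1 with
    | zero => simp
    | succ l => rw [derivative_X_pow, map_natCast, Nat.add_sub_cancel, mul_left_comm, ← pow_succ']
  rw [dehomogenize_pderiv_zero_monomial, dehomogenize_monomial, derivative_C_mul, C_mul,
    Derivation.leibniz, Derivation.leibniz, eulerDeriv_X_pow, eulerDeriv_C_X_pow, eulerDeriv_C,
    derivative_C, mul_left_comm X, hY, hn]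
  simp only [smul_eq_mul, mul_zero, C_0, add_zero, zero_add]
  ring

theorem weightedWronskian_dehomogenize {n n' : ℕ} {P Q : MvPolynomial (Fin 2) R}
    (hP : P.totalDegree ≤ n) (hQ : Q.totalDegree ≤ n') :
    weightedWronskian (n : R) n' (dehomogenize n P) (dehomogenize n' Q) =
      -dehomogenize (n - 1 + (n' - 1)) (MvPolynomial.pderiv 0 P * MvPolynomial.pderiv 1 Q -
        MvPolynomial.pderiv 1 P * MvPolynomial.pderiv 0 Q) := by
  have hdeg {N : ℕ} {F : MvPolynomial (Fin 2) R} (hF : F.totalDegree ≤ N) (i : Fin 2) :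
      (MvPolynomial.pderiv i F).totalDegree ≤ N - 1 :=
    (totalDegree_pderiv_le i F).trans (Nat.sub_le_sub_right hF 1)
  rw [map_sub, dehomogenize_mul (hdeg hP 0) (hdeg hQ 1), dehomogenize_mul (hdeg hP 1) (hdeg hQ 0),
    weightedWronskian, eulerDeriv_dehomogenize hP, eulerDeriv_dehomogenize hQ,
    ← derivative_dehomogenize, ← derivative_dehomogenize]
  simp only [map_natCast]
  ring

theorem exists_dehomogenize_aeval_mul_X_pow (n i : ℕ) (j : R[X]) :
    ∃ r : R[X], dehomogenize n (aeval (MvPolynomial.X 0 : MvPolynomial (Fin 2) R) j *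
      MvPolynomial.X 1 ^ i) = C r * X ^ i := by
  induction j using Polynomial.induction_on' with
  | add p q hp hq =>
    obtain ⟨r, hr⟩ := hp
    obtain ⟨r', hr'⟩ := hq
    exact ⟨r + r', by rw [map_add, add_mul, map_add, hr, hr', C_add, add_mul]⟩
  | monomial l a =>
    have hmon : aeval (MvPolynomial.X 0 : MvPolynomial (Fin 2) R) (monomial l a) *
        MvPolynomial.X 1 ^ i =
          MvPolynomial.monomial (Finsupp.single 0 l + Finsupp.single 1 i) a := by
      rw [aeval_monomial, MvPolynomial.algebraMap_eq, MvPolynomial.X_pow_eq_monomial,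
        MvPolynomial.X_pow_eq_monomial, MvPolynomial.C_mul_monomial, MvPolynomial.monomial_mul,
        mul_one, mul_one]
    refine ⟨C a * X ^ (n - l - i), ?_⟩
    rw [hmon, dehomogenize_monomial]
    simp

end Dehomogenize

section Chart

variable {R : Type*} [CommRing R]

/-- The polynomial `t ^ (m * n) * P (t ^ (-m), t ^ (-m) * Y)` in `t` (the inner variable) and `Y`:
it represents a polynomial `P` of total degree at most `n` near the line at infinity, in a chart
ramified of order `m` along that line. -/
noncomputable def chartAtInfinity (m n : ℕ) (P : MvPolynomial (Fin 2) R) : R[X][X] :=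
  (dehomogenize n P).map (expand R m : R[X] →+* R[X])

theorem map_expand_chartAtInfinity (r m n : ℕ) (P : MvPolynomial (Fin 2) R) :
    (chartAtInfinity m n P).map (expand R r : R[X] →+* R[X]) = chartAtInfinity (r * m) n P := by
  rw [chartAtInfinity, Polynomial.map_map]
  exact congrArg (fun φ => (dehomogenize n P).map φ) (RingHom.ext fun p => expand_expand r m p)

theorem exists_weightedWronskian_chartAtInfinity_eq (m : ℕ) {n n' : ℕ}
    {P Q : MvPolynomial (Fin 2) R} {j : R[X]} (hP : P.totalDegree ≤ n) (hQ : Q.totalDegree ≤ n')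
    (hj : MvPolynomial.pderiv 0 P * MvPolynomial.pderiv 1 Q -
      MvPolynomial.pderiv 1 P * MvPolynomial.pderiv 0 Q = aeval (MvPolynomial.X 0) j) :
    ∃ r, weightedWronskian ((m * n : ℕ) : R) ((m * n' : ℕ) : R) (chartAtInfinity m n P)
      (chartAtInfinity m n' Q) = C r := by
  obtain ⟨r, hr⟩ := exists_dehomogenize_aeval_mul_X_pow (n - 1 + (n' - 1)) 0 j
  rw [pow_zero, pow_zero, mul_one, mul_one, ← hj] at hr
  refine ⟨m * expand R m (-r), ?_⟩
  rw [Nat.cast_mul, Nat.cast_mul, chartAtInfinity, chartAtInfinity, weightedWronskian_map_expand,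
    weightedWronskian_dehomogenize hP hQ, hr, ← C_neg, map_C, C_mul, map_natCast, RingHom.coe_coe]

theorem evalEval_map_expand (m : ℕ) (F : R[X][X]) (t Y : R) :
    (F.map (expand R m : R[X] →+* R[X])).evalEval t Y = F.evalEval (t ^ m) Y := by
  rw [← map_evalRingHom_eval, ← map_evalRingHom_eval, Polynomial.map_map]
  exact congrArg (fun φ => (F.map φ).eval Y) (RingHom.ext fun p => expand_eval m p t)

variable {𝕜 : Type*} [Field 𝕜]

/-- The point of the affine plane with coordinates `t` and `Y` in the chart of `chartAtInfinity`.
It is meaningful only for `t ≠ 0`. -/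
def chartPoint (m : ℕ) (t Y : 𝕜) : Fin 2 → 𝕜 := ![(t ^ m)⁻¹, (t ^ m)⁻¹ * Y]

theorem evalEval_dehomogenize {n : ℕ} {P : MvPolynomial (Fin 2) 𝕜} (hP : P.totalDegree ≤ n) {t : 𝕜}
    (ht : t ≠ 0) (Y : 𝕜) :
    (dehomogenize n P).evalEval t Y = t ^ n * MvPolynomial.eval ![t⁻¹, t⁻¹ * Y] P := by
  refine induction_on_totalDegree_le (motive := fun P =>
      (dehomogenize n P).evalEval t Y = t ^ n * MvPolynomial.eval ![t⁻¹, t⁻¹ * Y] P)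
    hP (by simp) (fun F G hF hG => by simp only [map_add, evalEval_add, hF, hG, mul_add])
    fun s a hs => ?_
  have hpow : t ^ n * (t⁻¹ ^ s 0 * t⁻¹ ^ s 1) = t ^ (n - s 0 - s 1) := by
    rw [← pow_add, Nat.sub_sub, pow_sub₀ _ ht hs, inv_pow]
  rw [dehomogenize_monomial, MvPolynomial.eval_monomial, evalEval_mul, evalEval_C, eval_mul,
    eval_C, eval_pow, eval_X, ← hpow]
  simp [Finsupp.prod_fintype, Fin.prod_univ_two, mul_pow]
  ring

theorem evalEval_chartAtInfinity {n : ℕ} {P : MvPolynomial (Fin 2) 𝕜} (hP : P.totalDegree ≤ n)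
    (m : ℕ) {t : 𝕜} (ht : t ≠ 0) (Y : 𝕜) :
    (chartAtInfinity m n P).evalEval t Y =
      t ^ (m * n) * MvPolynomial.eval (chartPoint m t Y) P := by
  rw [chartAtInfinity, evalEval_map_expand, evalEval_dehomogenize hP (pow_ne_zero m ht), pow_mul,
    chartPoint]

theorem evalEval_comp (F q : R[X][X]) (t Y : R) :
    (F.comp q).evalEval t Y = F.evalEval t (q.evalEval t Y) := by
  rw [← map_evalRingHom_eval, Polynomial.map_comp, eval_comp, map_evalRingHom_eval,
    map_evalRingHom_eval]

theorem eval_chartPoint_of_comp_eq {m n k : ℕ} {P : MvPolynomial (Fin 2) 𝕜}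
    (hP : P.totalDegree ≤ n) {w : 𝕜[X]} {g : 𝕜[X][X]}
    (hg : (chartAtInfinity m n P).comp (C (X ^ k) * X + C w) = C (X ^ (m * n)) * g) {t : 𝕜}
    (ht : t ≠ 0) (ξ : 𝕜) :
    MvPolynomial.eval (chartPoint m t (t ^ k * ξ + w.eval t)) P = g.evalEval t ξ := by
  have h := congrArg (evalEval t ξ) hg
  rw [evalEval_comp, evalEval_mul, evalEval_C, evalEval_add, evalEval_mul, evalEval_C, evalEval_C,
    evalEval_X, evalEval_chartAtInfinity hP m ht, eval_pow, eval_pow, eval_X] at h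
  exact mul_left_cancel₀ (pow_ne_zero _ ht) h

end Chart

section MonicInY

open Puiseux Nat

theorem natDegree_C_mul_X_pow_add_sum {S : Type*} [Semiring S] {a : S} (ha : a ≠ 0) {n : ℕ}
    (r : Fin n → S) : (C a * X ^ n + ∑ i : Fin n, C (r i) * X ^ (i : ℕ)).natDegree = n := by
  refine natDegree_eq_of_degree_eq_some ?_
  rw [degree_add_eq_left_of_degree_lt, degree_C_mul_X_pow n ha]
  rw [degree_C_mul_X_pow n ha]
  exact degree_sum_fin_lt r

theorem leadingCoeff_C_mul_X_pow_add_sum {S : Type*} [Semiring S] {a : S} (ha : a ≠ 0) {n : ℕ}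
    (r : Fin n → S) : (C a * X ^ n + ∑ i : Fin n, C (r i) * X ^ (i : ℕ)).leadingCoeff = a := by
  rw [leadingCoeff_add_of_degree_lt', leadingCoeff_C_mul_X_pow]
  rw [degree_C_mul_X_pow n ha]
  exact degree_sum_fin_lt r

namespace IsMonicInY

variable {P Q : Poly} {n n' : ℕ} {A B : ℂ}

theorem exists_evalEval_eq (h : IsMonicInY P n A) : ∃ F : ℂ[X][X], F.natDegree = n ∧
    F.leadingCoeff = C A ∧ ∀ z, MvPolynomial.eval z P = F.evalEval (z 0) (z 1) := by
  obtain ⟨hA, a, rfl⟩ := h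
  refine ⟨_, natDegree_C_mul_X_pow_add_sum (C_ne_zero.2 hA) a,
    leadingCoeff_C_mul_X_pow_add_sum (C_ne_zero.2 hA) a, fun z => ?_⟩
  have haeval (p : ℂ[X]) : MvPolynomial.eval z (aeval (MvPolynomial.X 0) p) = p.eval (z 0) := by
    rw [← MvPolynomial.aeval_eq_eval, ← aeval_algHom_apply, MvPolynomial.aeval_X,
      coe_aeval_eq_eval]
  simp [evalEval_finsetSum, haeval, evalEval_C]

theorem exists_dehomogenize_eq (h : IsMonicInY P n A) : ∃ r : Fin n → ℂ[X],
    dehomogenize n P = C (C A) * X ^ n + ∑ i : Fin n, C (r i) * X ^ (i : ℕ) := by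
  obtain ⟨-, a, rfl⟩ := h
  choose r hr using fun i : Fin n => exists_dehomogenize_aeval_mul_X_pow n i (a i)
  have hlead : (MvPolynomial.C A * MvPolynomial.X 1 ^ n : Poly) =
      MvPolynomial.monomial (Finsupp.single 1 n) A := by
    rw [MvPolynomial.X_pow_eq_monomial, MvPolynomial.C_mul_monomial, mul_one]
  refine ⟨r, ?_⟩
  rw [map_add, map_sum, hlead, dehomogenize_monomial]
  simp [hr]

theorem natDegree_chartAtInfinity (h : IsMonicInY P n A) {m : ℕ} (hm : m ≠ 0) :
    (chartAtInfinity m n P).natDegree = n := by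
  obtain ⟨r, hr⟩ := h.exists_dehomogenize_eq
  rw [chartAtInfinity, natDegree_map_eq_of_injective (f := (expand ℂ m : ℂ[X] →+* ℂ[X]))
    (expand_injective hm.bot_lt), hr,
    natDegree_C_mul_X_pow_add_sum (C_ne_zero.2 h.1)]

theorem leadingCoeff_chartAtInfinity (h : IsMonicInY P n A) {m : ℕ} (hm : m ≠ 0) :
    (chartAtInfinity m n P).leadingCoeff = C A := by
  obtain ⟨r, hr⟩ := h.exists_dehomogenize_eq
  rw [chartAtInfinity, leadingCoeff_map_of_injective (f := (expand ℂ m : ℂ[X] →+* ℂ[X]))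
    (expand_injective hm.bot_lt), hr,
    leadingCoeff_C_mul_X_pow_add_sum (C_ne_zero.2 h.1), RingHom.coe_coe, expand_C]

theorem exists_hasApproxRoots (h : IsMonicInY P n A) : ∃ s ≠ 0, ∀ N, ∃ u : Fin n → ℂ[X],
    HasApproxRoots (chartAtInfinity s n P) A u N := by
  obtain ⟨r, hr⟩ := h.exists_dehomogenize_eq
  have hA : (C (C A⁻¹) * dehomogenize n P).leadingCoeff = 1 := by
    rw [leadingCoeff_mul, leadingCoeff_C, hr, leadingCoeff_C_mul_X_pow_add_sum (C_ne_zero.2 h.1),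
      ← C_mul, inv_mul_cancel₀ h.1, C_1]
  have hn : (C (C A⁻¹) * dehomogenize n P).natDegree = n := by
    rw [natDegree_C_mul (C_ne_zero.2 (inv_ne_zero h.1)), hr,
      natDegree_C_mul_X_pow_add_sum (C_ne_zero.2 h.1)]
  obtain ⟨s, hs, hroots⟩ := Puiseux.exists_hasApproxRoots hA hn
  refine ⟨s, hs, fun N => (hroots N).imp fun u hu => ?_⟩
  have hscale : C (C A) * (C (C A⁻¹) * dehomogenize n P).map (expand ℂ s : ℂ[X] →+* ℂ[X]) =
      chartAtInfinity s n P := by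
    rw [Polynomial.map_mul, map_C, RingHom.coe_coe, expand_C, ← mul_assoc, ← C_mul, ← C_mul,
      mul_inv_cancel₀ h.1, C_1, C_1, one_mul, chartAtInfinity]
  rw [HasApproxRoots, C_1, C_1, one_mul] at hu
  rw [HasApproxRoots, ← hscale, ← mul_sub]
  exact hu.mul_left _

theorem exists_common_hasApproxRoots (hP : IsMonicInY P n A) (hQ : IsMonicInY Q n' B) (S : ℕ)
    (hS : S ≠ 0) :
    ∃ m ≠ 0, S ∣ m ∧ ∀ N, ∃ (u : Fin n → ℂ[X]) (v : Fin n' → ℂ[X]),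
      HasApproxRoots (chartAtInfinity m n P) A (fun i => expand ℂ S (u i)) N ∧
      HasApproxRoots (chartAtInfinity m n' Q) B (fun i => expand ℂ S (v i)) N := by
  obtain ⟨s, hs, hu⟩ := hP.exists_hasApproxRoots
  obtain ⟨s', hs', hv⟩ := hQ.exists_hasApproxRoots
  refine ⟨S * s' * s, mul_ne_zero (mul_ne_zero hS hs') hs, ⟨s' * s, mul_assoc S s' s⟩, fun N => ?_⟩
  obtain ⟨u, hu⟩ := hu N
  obtain ⟨v, hv⟩ := hv N
  refine ⟨fun i => expand ℂ s' (u i), fun i => expand ℂ s (v i), ?_, ?_⟩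
  · simpa only [map_expand_chartAtInfinity, expand_expand] using hu.map_expand (mul_ne_zero hS hs')
  · simpa only [map_expand_chartAtInfinity, expand_expand, mul_right_comm S s s'] using
      hv.map_expand (mul_ne_zero hS hs)

end IsMonicInY

theorem dvd_natTrailingDegree_expand {R : Type*} [CommSemiring R] {S : ℕ} (hS : S ≠ 0) {v : R[X]}
    (hv : expand R S v ≠ 0) : S ∣ (expand R S v).natTrailingDegree := by
  by_contra hdvd
  refine mem_support_iff.1 (natTrailingDegree_mem_support_of_nonzero hv) ?_
  rw [coeff_expand hS.bot_lt, if_neg hdvd]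

end MonicInY

/-! ### Non-proper values as limits along branches -/

section Asymptotics

open Asymptotics Filter NewtonChain Puiseux

variable {𝕜 γ : Type*} [NormedField 𝕜] {l : Filter γ} {t Y : γ → 𝕜}

theorem isBigO_eval_one (p : 𝕜[X]) (ht : t =O[l] fun _ => (1 : 𝕜)) :
    (fun s => p.eval (t s)) =O[l] fun _ => (1 : 𝕜) := by
  induction p using Polynomial.induction_on' with
  | add p q hp hq => simpa only [eval_add] using hp.add hq
  | monomial n a =>
    simpa only [eval_monomial, one_pow] using (ht.pow n).const_mul_left a

theorem isBigO_evalEval_one (F : 𝕜[X][X]) (ht : t =O[l] fun _ => (1 : 𝕜))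
    (hY : Y =O[l] fun _ => (1 : 𝕜)) :
    (fun s => F.evalEval (t s) (Y s)) =O[l] fun _ => (1 : 𝕜) := by
  induction F using Polynomial.induction_on' with
  | add F G hF hG => simpa only [evalEval_add] using hF.add hG
  | monomial n p =>
    simp only [← C_mul_X_pow_eq_monomial, evalEval_mul, evalEval_C, evalEval_pow, evalEval_X]
    simpa only [one_pow, one_mul] using (isBigO_eval_one p ht).mul (hY.pow n)

theorem norm_le_of_isRoot {p : 𝕜[X]} (hp : p ≠ 0) {y : 𝕜} (hy : p.IsRoot y) :
    ‖y‖ ≤ (∑ i ∈ Finset.range p.natDegree, ‖p.coeff i‖) / ‖p.leadingCoeff‖ + 1 := by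
  have hsup : cauchyBound p ≤
      (∑ i ∈ Finset.range p.natDegree, ‖p.coeff i‖₊) / ‖p.leadingCoeff‖₊ + 1 := by
    rw [cauchyBound]
    gcongr
    exact Finset.sup_le fun i hi => Finset.single_le_sum (f := fun i => ‖p.coeff i‖₊)
      (fun _ _ => zero_le) hi
  simpa using NNReal.coe_le_coe.2 ((hy.norm_lt_cauchyBound hp).le.trans hsup)

theorem isBigO_one_of_evalEval {F : 𝕜[X][X]} {A : 𝕜} (hF : F.natDegree ≠ 0) (hA : A ≠ 0)
    (hlead : F.leadingCoeff = C A) (ht : t =O[l] fun _ => (1 : 𝕜))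
    (hFY : (fun s => F.evalEval (t s) (Y s)) =O[l] fun _ => (1 : 𝕜)) :
    Y =O[l] fun _ => (1 : 𝕜) := by
  let p (s : γ) : 𝕜[X] := F.map (evalRingHom (t s)) - C (F.evalEval (t s) (Y s))
  have hlead' (s : γ) : evalRingHom (t s) F.leadingCoeff ≠ 0 := by simpa [hlead] using hA
  have hdeg (s : γ) : (p s).natDegree = F.natDegree := by
    rw [natDegree_sub_C, natDegree_map_of_leadingCoeff_ne_zero _ (hlead' s)]
  have hp (s : γ) : (p s).leadingCoeff = A := by
    rw [leadingCoeff, hdeg, coeff_sub, coeff_C_of_ne_zero hF, sub_zero, coeff_map, coeff_natDegree,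
      hlead, coe_evalRingHom, eval_C]
  have hroot (s : γ) : (p s).IsRoot (Y s) := by
    rw [IsRoot.def, eval_sub, eval_C, map_evalRingHom_eval, sub_self]
  have hcoeff (i : ℕ) : (fun s => ‖(p s).coeff i‖) =O[l] fun _ => (1 : 𝕜) := by
    refine IsBigO.norm_left ?_
    simp only [p, coeff_sub, coeff_map, coe_evalRingHom, coeff_C]
    refine (isBigO_eval_one _ ht).sub ?_
    split_ifs
    exacts [hFY, isBigO_zero _ _]
  refine IsBigO.trans (IsBigO.of_bound' (.of_forall fun s => ?_)) <|
    ((IsBigO.fun_sum fun i (_ : i ∈ Finset.range F.natDegree) => hcoeff i).const_mul_left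
      ‖A‖⁻¹).add (isBigO_const_const (1 : ℝ) (one_ne_zero (α := 𝕜)) l)
  have hbound := norm_le_of_isRoot (leadingCoeff_ne_zero.1 ((hp s).trans_ne hA)) (hroot s)
  rw [hdeg, hp, div_eq_inv_mul] at hbound
  exact hbound.trans (Real.le_norm_self _)

theorem isBigO_pow_natTrailingDegree_eval {v : 𝕜[X]} (hv : v ≠ 0) :
    (fun t => t ^ v.natTrailingDegree) =O[𝓝 0] fun t => v.eval t := by
  obtain ⟨b, hb⟩ := (X_pow_dvd_iff_le_natTrailingDegree hv).2 le_rfl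
  have hb0 : b.eval 0 ≠ 0 := by
    rwa [← coeff_zero_eq_eval_zero, ← coeff_X_pow_mul b v.natTrailingDegree 0, zero_add, ← hb, Ne,
      ← trailingCoeff, trailingCoeff_eq_zero]
  have hlim : (fun _ => b.eval 0) =O[𝓝 0] fun t => b.eval t :=
    ((isEquivalent_const_iff_tendsto hb0).2 (b.continuous.tendsto 0)).isBigO_symm
  have hmul := (isBigO_refl (fun t : 𝕜 => t ^ v.natTrailingDegree) (𝓝 0)).mul
    ((isBigO_const_const (1 : 𝕜) hb0 (𝓝 0)).trans hlim)
  refine (hmul.congr_left fun t => mul_one _).congr_right fun t => ?_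
  conv_rhs => rw [hb]
  rw [eval_mul, eval_pow, eval_X]

theorem isBigO_truncOrder {u w : 𝕜[X]} (ht : Tendsto t l (𝓝[≠] 0)) (k : ℕ)
    (hnear : (fun s => Y s - w.eval (t s)) =O[l] fun s => Y s - u.eval (t s)) :
    (fun s => t s ^ truncOrder k (w - u) *
      ((Y s - w.eval (t s)) / t s ^ k) ^ (residueFactor k (w - u)).natDegree) =O[l]
        fun s => Y s - u.eval (t s) := by
  obtain ⟨ht₀, hne⟩ := tendsto_nhdsWithin_iff.1 ht
  by_cases h : X ^ k ∣ w - u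
  · rw [residueFactor_of_dvd h, truncOrder_of_dvd h, natDegree_X_add_C]
    refine hnear.congr' ?_ .rfl
    filter_upwards [hne] with s hs
    rw [pow_one, mul_div_cancel₀ _ (pow_ne_zero k hs)]
  · rw [residueFactor_of_not_dvd h, truncOrder_of_not_dvd h, natDegree_C]
    have hsub := (isBigO_refl (fun s => Y s - u.eval (t s)) l).sub hnear
    refine (((isBigO_pow_natTrailingDegree_eval (v := w - u) fun h0 =>
      h (h0 ▸ dvd_zero _)).comp_tendsto ht₀).trans
      (hsub.congr_left fun s => ?_)).congr_left fun s => ?_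
    · rw [Function.comp_apply, eval_sub]
      ring
    · rw [Function.comp_apply, pow_zero, mul_one]

variable {ι : Type*} [Fintype ι] {G : 𝕜[X][X]} {A : 𝕜} {u : ι → 𝕜[X]} {w : 𝕜[X]} {N D : ℕ}

theorem isBigO_totalOrder_prod (hA : A ≠ 0) (ht : Tendsto t l (𝓝[≠] 0))
    (hnear : ∀ i, (fun s => Y s - w.eval (t s)) =O[l] fun s => Y s - (u i).eval (t s)) (k : ℕ) :
    (fun s => t s ^ totalOrder (fun i => w - u i) k *
      ((Y s - w.eval (t s)) / t s ^ k) ^ (residuePoly A (fun i => w - u i) k).natDegree) =O[l]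
        fun s => ∏ i, (Y s - (u i).eval (t s)) := by
  refine (IsBigO.finsetProd fun i (_ : i ∈ Finset.univ) =>
    isBigO_truncOrder ht k (hnear i)).congr_left fun s => ?_
  rw [Finset.prod_mul_distrib, Finset.prod_pow_eq_pow_sum, Finset.prod_pow_eq_pow_sum, totalOrder,
    natDegree_residuePoly hA]

theorem isBigO_prod_of_hasApproxRoots (hu : HasApproxRoots G A u N) (hA : A ≠ 0) (hD : D ≤ N)
    (ht : t =O[l] fun _ => (1 : 𝕜)) (hY : Y =O[l] fun _ => (1 : 𝕜))
    (hG : (fun s => G.evalEval (t s) (Y s)) =O[l] fun s => t s ^ D) :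
    (fun s => ∏ i, (Y s - (u i).eval (t s))) =O[l] fun s => t s ^ D := by
  obtain ⟨E, hE⟩ := hu
  have hpow : (fun s => t s ^ N * E.evalEval (t s) (Y s)) =O[l] fun s => t s ^ D := by
    refine (((isBigO_refl (fun s => t s ^ D) l).mul (ht.pow (N - D))).mul
      (isBigO_evalEval_one E ht hY)).congr (fun s => ?_) fun s => ?_
    · rw [← pow_add, Nat.add_sub_cancel' hD]
    · rw [one_pow, mul_one, mul_one]
  refine ((hG.sub hpow).const_mul_left A⁻¹).congr_left fun s => ?_
  have hs := congrArg (evalEval (t s) (Y s)) hE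
  simp only [evalEval_sub, evalEval_mul, evalEval_C, evalEval_prod, evalEval_X, eval_pow, eval_X,
    eval_C] at hs
  rw [← hs, sub_sub_cancel, inv_mul_cancel_left₀ hA]

theorem isBigO_totalOrder_of_hasApproxRoots (hu : HasApproxRoots G A u N) (hA : A ≠ 0)
    (hD : D ≤ N) (ht : Tendsto t l (𝓝[≠] 0)) (hY : Y =O[l] fun _ => (1 : 𝕜))
    (hG : (fun s => G.evalEval (t s) (Y s)) =O[l] fun s => t s ^ D)
    (hnear : ∀ i, (fun s => Y s - w.eval (t s)) =O[l] fun s => Y s - (u i).eval (t s)) (k : ℕ) :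
    (fun s => t s ^ totalOrder (fun i => w - u i) k *
      ((Y s - w.eval (t s)) / t s ^ k) ^ (residuePoly A (fun i => w - u i) k).natDegree) =O[l]
        fun s => t s ^ D :=
  (isBigO_totalOrder_prod hA ht hnear k).trans <| isBigO_prod_of_hasApproxRoots hu hA hD
    ((tendsto_nhdsWithin_iff.1 ht).1.isBigO_one 𝕜) hY hG

theorem le_totalOrder_of_hasApproxRoots [l.NeBot] (hu : HasApproxRoots G A u N) (hA : A ≠ 0)
    (hD : D ≤ N) (ht : Tendsto t l (𝓝[≠] 0)) (hY : Y =O[l] fun _ => (1 : 𝕜))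
    (hG : (fun s => G.evalEval (t s) (Y s)) =O[l] fun s => t s ^ D)
    (hnear : ∀ i, (fun s => Y s - w.eval (t s)) =O[l] fun s => Y s - (u i).eval (t s)) :
    D ≤ totalOrder (fun i => w - u i) D := by
  by_contra! hlt
  obtain ⟨ht₀, hne⟩ := tendsto_nhdsWithin_iff.1 ht
  have hdeg : (residuePoly A (fun i => w - u i) D).natDegree = 0 := by
    have hmul := (mul_natDegree_le_totalOrder (v := fun i => w - u i) hA D).trans_lt hlt
    exact Nat.lt_one_iff.1 (lt_of_mul_lt_mul_left (hmul.trans_eq (mul_one D).symm) D.zero_le)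
  have hO := isBigO_totalOrder_of_hasApproxRoots hu hA hD ht hY hG hnear D
  simp only [hdeg, pow_zero, mul_one] at hO
  exact hO.not_isLittleO (hne.mono fun s hs => pow_ne_zero _ hs).frequently
    ((isLittleO_pow_pow hlt).comp_tendsto ht₀)

theorem isBigO_one_of_totalOrder_eq (hu : HasApproxRoots G A u N) (hA : A ≠ 0)
    (hD : D ≤ N) (ht : Tendsto t l (𝓝[≠] 0)) (hY : Y =O[l] fun _ => (1 : 𝕜))
    (hG : (fun s => G.evalEval (t s) (Y s)) =O[l] fun s => t s ^ D)
    (hnear : ∀ i, (fun s => Y s - w.eval (t s)) =O[l] fun s => Y s - (u i).eval (t s)) {k : ℕ}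
    (hk : totalOrder (fun i => w - u i) k = D)
    (hdeg : (residuePoly A (fun i => w - u i) k).natDegree ≠ 0) :
    (fun s => (Y s - w.eval (t s)) / t s ^ k) =O[l] fun _ => (1 : 𝕜) := by
  have hO := isBigO_totalOrder_of_hasApproxRoots hu hA hD ht hY hG hnear k
  rw [hk] at hO
  have hdiv := (isBigO_refl (fun s => (t s ^ D)⁻¹) l).mul hO
  refine .of_pow hdeg (hdiv.congr' ?_ ?_) <;>
    filter_upwards [(tendsto_nhdsWithin_iff.1 ht).2] with s hs
  · rw [inv_mul_cancel_left₀ (pow_ne_zero D hs), Pi.pow_apply]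
  · rw [inv_mul_cancel₀ (pow_ne_zero D hs), Pi.pow_apply, one_pow]

end Asymptotics

section NonProperValues

open Asymptotics Filter NewtonChain

theorem mem_nonProperValueSet_iff_mapClusterPt {f : Plane → Plane} (hf : Continuous f)
    {a : Plane} : a ∈ nonProperValueSet f ↔ MapClusterPt a (cocompact Plane) f := by
  rw [mapClusterPt_iff_frequently]
  refine ⟨fun ha s hs hev => ?_, fun ha K hK _ hcomp => ha K hK hcomp.compl_mem_cocompact⟩
  obtain ⟨K, hK, hKs, hcomp⟩ := local_compact_nhds hs
  obtain ⟨T, hT, hTK⟩ := mem_cocompact.1 hev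
  refine ha K hK hcomp (hT.of_isClosed_subset (hcomp.isClosed.preimage hf) ?_)
  intro z hz
  by_contra hzT
  exact hTK hzT (hKs hz)

theorem continuous_polyMap (P Q : Poly) : Continuous (polyMap P Q) :=
  continuous_pi <| Fin.forall_fin_two.2
    ⟨MvPolynomial.continuous_eval P, MvPolynomial.continuous_eval Q⟩

theorem tendsto_cobounded_of_isMonicInY {P : Poly} {n : ℕ} {A : ℂ} (hP : IsMonicInY P n A)
    (hn : n ≠ 0) {l : Ultrafilter Plane} (hl : (l : Filter Plane) ≤ cocompact Plane)
    (hbound : (fun z => MvPolynomial.eval z P) =O[l] fun _ => (1 : ℂ)) :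
    Tendsto (fun z : Plane => z 0) l (Bornology.cobounded ℂ) := by
  rw [← tendsto_norm_atTop_iff_cobounded, tendsto_atTop]
  by_contra! ⟨R, hR⟩
  have h₀ : (fun z : Plane => z 0) =O[l] fun _ => (1 : ℂ) := by
    refine .of_bound R ?_
    filter_upwards [hR] with z hz
    simpa using hz.le
  obtain ⟨F, hFn, hFA, hF⟩ := hP.exists_evalEval_eq
  simp only [hF] at hbound
  have h₁ := isBigO_one_of_evalEval (hFn.trans_ne hn) hP.1 hFA h₀ hbound
  have hid : (fun z : Plane => z) =O[l] fun _ => (1 : ℂ) :=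
    isBigO_pi.2 (Fin.forall_fin_two.2 ⟨h₀, h₁⟩)
  exact not_isBoundedUnder_of_tendsto_atTop (tendsto_norm_cocompact_atTop.mono_left hl)
    ((isBigO_one_iff ℂ).1 hid)

section Branch

variable {γ : Type*} {P Q : Poly} {n m : ℕ} {l : Filter γ} {t Y : γ → ℂ} {a : Plane}

theorem isBigO_evalEval_chartAtInfinity (hP : P.totalDegree ≤ n) (ht : ∀ᶠ s in l, t s ≠ 0)
    (hbound : (fun s => MvPolynomial.eval (chartPoint m (t s) (Y s)) P) =O[l] fun _ => (1 : ℂ)) :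
    (fun s => (chartAtInfinity m n P).evalEval (t s) (Y s)) =O[l] fun s => t s ^ (m * n) := by
  refine ((isBigO_refl (fun s => t s ^ (m * n)) l).mul hbound).congr' ?_ ?_
  · filter_upwards [ht] with s hs
    rw [evalEval_chartAtInfinity hP m hs]
  · exact .of_forall fun _ => mul_one _

/-- A way of approaching the value `a` of the map `(P, Q)` from infinity: the points with
coordinates `t` and `Y` in the `m`-th chart escape to infinity along the filter `l`, with `Y`
bounded, and their images tend to `a`. -/
structure IsBranch (m : ℕ) (P Q : Poly) (l : Filter γ) (t Y : γ → ℂ) (a : Plane) : Prop where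
  tendsto_nhdsNE : Tendsto t l (𝓝[≠] 0)
  isBigO_one : Y =O[l] fun _ => (1 : ℂ)
  tendsto_polyMap : Tendsto (fun s => polyMap P Q (chartPoint m (t s) (Y s))) l (𝓝 a)

theorem exists_isBranch {A : ℂ} (hn : n ≠ 0) (hm : m ≠ 0) (hdeg : P.totalDegree ≤ n)
    (hP : IsMonicInY P n A) (ha : a ∈ nonProperValueSet (polyMap P Q)) :
    ∃ (l : Ultrafilter Plane) (t Y : Plane → ℂ), IsBranch m P Q l t Y a := by
  obtain ⟨l, hl, hla⟩ := mapClusterPt_iff_ultrafilter.1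
    ((mem_nonProperValueSet_iff_mapClusterPt (continuous_polyMap P Q)).1 ha)
  have hbound : (fun z => MvPolynomial.eval z P) =O[l] fun _ => (1 : ℂ) :=
    (tendsto_pi_nhds.1 hla 0).isBigO_one ℂ
  choose t ht using fun z : Plane => IsAlgClosed.exists_pow_nat_eq (z 0)⁻¹ (Nat.pos_of_ne_zero hm)
  have htm : Tendsto (fun z => t z ^ m) l (𝓝[≠] 0) := by
    simp only [ht]
    exact tendsto_inv₀_cobounded'.comp (tendsto_cobounded_of_isMonicInY hP hn hl hbound)
  obtain ⟨htm₀, htm₁⟩ := tendsto_nhdsWithin_iff.1 htm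
  have ht₁ : ∀ᶠ z in l, t z ≠ 0 := htm₁.mono fun z hz => (pow_ne_zero_iff hm).1 hz
  have ht₀ : Tendsto t l (𝓝 0) := by
    refine (isLittleO_one_iff ℂ).1 (IsLittleO.of_pow (n := m) ?_ hm)
    simpa [Pi.pow_def] using htm₀
  have hpoint : ∀ᶠ z in l, chartPoint m (t z) (t z ^ m * z 1) = z := by
    filter_upwards [ht₁] with z hz
    rw [chartPoint, inv_mul_cancel_left₀ (pow_ne_zero m hz), ht, inv_inv]
    exact funext (Fin.forall_fin_two.2 ⟨rfl, rfl⟩)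
  have hpoint_comp {β : Type} (φ : Plane → β) :
      φ =ᶠ[l] fun z => φ (chartPoint m (t z) (t z ^ m * z 1)) := by
    filter_upwards [hpoint] with z hz
    rw [hz]
  refine ⟨l, t, fun z => t z ^ m * z 1, tendsto_nhdsWithin_iff.2 ⟨ht₀, ht₁⟩, ?_, ?_⟩
  · refine isBigO_one_of_evalEval ((hP.natDegree_chartAtInfinity hm).trans_ne hn) hP.1
      (hP.leadingCoeff_chartAtInfinity hm) (ht₀.isBigO_one ℂ) ?_
    exact (isBigO_evalEval_chartAtInfinity hdeg ht₁ (hbound.congr' (hpoint_comp _) .rfl)).trans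
      ((ht₀.pow (m * n)).isBigO_one ℂ)
  · exact hla.congr' (hpoint_comp _)

theorem IsBranch.isBigO_evalEval_left (h : IsBranch m P Q l t Y a) (hP : P.totalDegree ≤ n) :
    (fun s => (chartAtInfinity m n P).evalEval (t s) (Y s)) =O[l] fun s => t s ^ (m * n) :=
  isBigO_evalEval_chartAtInfinity hP (tendsto_nhdsWithin_iff.1 h.tendsto_nhdsNE).2
    ((tendsto_pi_nhds.1 h.tendsto_polyMap 0).isBigO_one ℂ)

theorem IsBranch.isBigO_evalEval_right (h : IsBranch m P Q l t Y a) (hQ : Q.totalDegree ≤ n) :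
    (fun s => (chartAtInfinity m n Q).evalEval (t s) (Y s)) =O[l] fun s => t s ^ (m * n) :=
  isBigO_evalEval_chartAtInfinity hQ (tendsto_nhdsWithin_iff.1 h.tendsto_nhdsNE).2
    ((tendsto_pi_nhds.1 h.tendsto_polyMap 1).isBigO_one ℂ)

end Branch

theorem continuous_evalEval (F : ℂ[X][X]) : Continuous fun z : ℂ × ℂ => F.evalEval z.1 z.2 := by
  induction F using Polynomial.induction_on' with
  | add F G hF hG => simpa only [evalEval_add, Pi.add_def] using hF.add hG
  | monomial n p =>
    simp only [← C_mul_X_pow_eq_monomial, evalEval_mul, evalEval_C, evalEval_pow, evalEval_X]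
    fun_prop

theorem tendsto_eval_chartPoint {P : Poly} {n m k : ℕ} {w p : ℂ[X]} (hP : P.totalDegree ≤ n)
    (hp : HasLeadingForm (chartAtInfinity m n P) w k (m * n) p) {γ : Type*} {l : Filter γ}
    {t ξ : γ → ℂ} {ξ₀ : ℂ} (ht : Tendsto t l (𝓝[≠] 0)) (hξ : Tendsto ξ l (𝓝 ξ₀)) :
    Tendsto (fun s => MvPolynomial.eval (chartPoint m (t s) (t s ^ k * ξ s + w.eval (t s))) P) l
      (𝓝 (p.eval ξ₀)) := by
  obtain ⟨g, hg, rfl⟩ := hp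
  obtain ⟨ht₀, ht₁⟩ := tendsto_nhdsWithin_iff.1 ht
  rw [map_evalRingHom_eval]
  refine (((continuous_evalEval g).tendsto (0, ξ₀)).comp (ht₀.prodMk_nhds hξ)).congr' ?_
  filter_upwards [ht₁] with s hs
  exact (eval_chartPoint_of_comp_eq hP hg hs (ξ s)).symm

/-- The curve in the plane with parametrization `(p, q)`. -/
def curve (p q : ℂ[X]) : Set Plane := Set.range fun ξ : ℂ => ![p.eval ξ, q.eval ξ]

variable {P Q : Poly} {n n' m k : ℕ} {w p q : ℂ[X]}

theorem tendsto_polyMap_chartPoint (hP : P.totalDegree ≤ n) (hQ : Q.totalDegree ≤ n')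
    (hp : HasLeadingForm (chartAtInfinity m n P) w k (m * n) p)
    (hq : HasLeadingForm (chartAtInfinity m n' Q) w k (m * n') q) {γ : Type*} {l : Filter γ}
    {t ξ : γ → ℂ} {ξ₀ : ℂ} (ht : Tendsto t l (𝓝[≠] 0)) (hξ : Tendsto ξ l (𝓝 ξ₀)) :
    Tendsto (fun s => polyMap P Q (chartPoint m (t s) (t s ^ k * ξ s + w.eval (t s)))) l
      (𝓝 ![p.eval ξ₀, q.eval ξ₀]) :=
  tendsto_pi_nhds.2 <| Fin.forall_fin_two.2
    ⟨tendsto_eval_chartPoint hP hp ht hξ, tendsto_eval_chartPoint hQ hq ht hξ⟩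

theorem tendsto_chartPoint_cocompact (hm : m ≠ 0) (Y : ℂ → ℂ) :
    Tendsto (fun t => chartPoint m t (Y t)) (𝓝[≠] 0) (cocompact Plane) := by
  have hpow : Tendsto (fun t : ℂ => ‖(t ^ m)⁻¹‖) (𝓝[≠] 0) atTop := by
    simp only [← inv_pow]
    exact tendsto_norm_cobounded_atTop.comp <|
      (tendsto_pow_cobounded_cobounded hm).comp tendsto_inv₀_nhdsNE_zero
  rw [← Metric.cobounded_eq_cocompact, ← tendsto_norm_atTop_iff_cobounded]
  exact tendsto_atTop_mono (fun t => norm_le_pi_norm (chartPoint m t (Y t)) 0) hpow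

theorem curve_subset_nonProperValueSet (hm : m ≠ 0) (hP : P.totalDegree ≤ n)
    (hQ : Q.totalDegree ≤ n') (hp : HasLeadingForm (chartAtInfinity m n P) w k (m * n) p)
    (hq : HasLeadingForm (chartAtInfinity m n' Q) w k (m * n') q) :
    curve p q ⊆ nonProperValueSet (polyMap P Q) := by
  rintro _ ⟨ξ, rfl⟩
  rw [mem_nonProperValueSet_iff_mapClusterPt (continuous_polyMap P Q)]
  exact .of_comp (tendsto_chartPoint_cocompact hm fun t => t ^ k * ξ + w.eval t)
    (tendsto_polyMap_chartPoint hP hQ hp hq tendsto_id tendsto_const_nhds).mapClusterPt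

theorem IsBranch.mem_curve {γ : Type*} {l : Ultrafilter γ} {t Y : γ → ℂ} {a : Plane}
    (h : IsBranch m P Q l t Y a) (hP : P.totalDegree ≤ n) (hQ : Q.totalDegree ≤ n')
    (hp : HasLeadingForm (chartAtInfinity m n P) w k (m * n) p)
    (hq : HasLeadingForm (chartAtInfinity m n' Q) w k (m * n') q)
    (hbound : (fun s => (Y s - w.eval (t s)) / t s ^ k) =O[l] fun _ => (1 : ℂ)) :
    a ∈ curve p q := by
  obtain ⟨R, hR⟩ := hbound.bound
  obtain ⟨ξ₀, -, hξ₀⟩ := isCompact_iff_ultrafilter_le_nhds'.1 (isCompact_closedBall (0 : ℂ) R)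
    (l.map fun s => (Y s - w.eval (t s)) / t s ^ k) (Ultrafilter.mem_map.2 <| by
      filter_upwards [hR] with s hs
      simpa only [Set.mem_preimage, mem_closedBall_zero_iff, norm_one, mul_one] using hs)
  refine ⟨ξ₀, tendsto_nhds_unique ((tendsto_polyMap_chartPoint hP hQ hp hq h.tendsto_nhdsNE
    hξ₀).congr' ?_) h.tendsto_polyMap⟩
  filter_upwards [(tendsto_nhdsWithin_iff.1 h.tendsto_nhdsNE).2] with s hs
  rw [mul_div_cancel₀ _ (pow_ne_zero k hs), sub_add_cancel]

end NonProperValues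

/-! ### Irreducible components -/

section ZariskiCurves

theorem isTopologicalBasis_zariski :
    @TopologicalSpace.IsTopologicalBasis Plane zariski
      {U | ∃ g : Poly, U = {z | MvPolynomial.eval z g ≠ 0}} := by
  refine @TopologicalSpace.isTopologicalBasis_of_subbasis_of_finiteInter Plane zariski _ rfl
    ⟨⟨1, by simp⟩, ?_⟩
  rintro _ ⟨g, rfl⟩ _ ⟨h, rfl⟩
  refine ⟨g * h, Set.ext fun z => ?_⟩
  simp

theorem eval_aeval_pair (p q : ℂ[X]) (g : Poly) (ξ : ℂ) :
    (MvPolynomial.aeval ![p, q] g).eval ξ = MvPolynomial.eval ![p.eval ξ, q.eval ξ] g := by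
  have hcoeff : (evalRingHom ξ).comp (algebraMap ℂ ℂ[X]) = RingHom.id ℂ :=
    RingHom.ext fun _ => eval_C
  have hcoord : (fun i => evalRingHom ξ (![p, q] i)) = ![p.eval ξ, q.eval ξ] :=
    funext (Fin.forall_fin_two.2 ⟨rfl, rfl⟩)
  rw [← coe_evalRingHom, MvPolynomial.map_aeval, hcoeff, hcoord]
  rfl

theorem isIrreducible_curve (p q : ℂ[X]) : @IsIrreducible Plane zariski (curve p q) := by
  refine ⟨Set.range_nonempty _, ?_⟩
  rintro U V hU hV ⟨_, ⟨ξ, rfl⟩, hξ⟩ ⟨_, ⟨η, rfl⟩, hη⟩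
  obtain ⟨_, ⟨g, rfl⟩, hg, hgU⟩ :=
    @TopologicalSpace.IsTopologicalBasis.exists_subset_of_mem_open Plane zariski _
      isTopologicalBasis_zariski _ _ hξ hU
  obtain ⟨_, ⟨h, rfl⟩, hh, hhV⟩ :=
    @TopologicalSpace.IsTopologicalBasis.exists_subset_of_mem_open Plane zariski _
      isTopologicalBasis_zariski _ _ hη hV
  simp only [Set.mem_ofPred_eq, ← eval_aeval_pair] at hg hh
  have hne {r : ℂ[X]} {ζ : ℂ} (hr : r.eval ζ ≠ 0) : r ≠ 0 := fun h0 => hr (by rw [h0, eval_zero])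
  obtain ⟨ζ, hζ⟩ : ∃ ζ,
      (MvPolynomial.aeval ![p, q] g * MvPolynomial.aeval ![p, q] h).eval ζ ≠ 0 := by
    by_contra! h0
    exact mul_ne_zero (hne hg) (hne hh) (Polynomial.funext fun ζ => by rw [h0, eval_zero])
  rw [eval_mul, eval_aeval_pair, eval_aeval_pair] at hζ
  exact ⟨_, ⟨ζ, rfl⟩, hgU (left_ne_zero_of_mul hζ), hhV (right_ne_zero_of_mul hζ)⟩

/-- The resultant of `p - x` and `q - y`: an implicit equation of the curve with parametrization
`(p, q)`. -/
noncomputable def implicitEquation (p q : ℂ[X]) : Poly :=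
  resultant (p.map MvPolynomial.C - C (MvPolynomial.X 0))
    (q.map MvPolynomial.C - C (MvPolynomial.X 1)) p.natDegree q.natDegree

theorem eval_implicitEquation (p q : ℂ[X]) (z : Plane) :
    MvPolynomial.eval z (implicitEquation p q) =
      resultant (p - C (z 0)) (q - C (z 1)) (p - C (z 0)).natDegree (q - C (z 1)).natDegree := by
  have hmap (r : ℂ[X]) (i : Fin 2) : (r.map MvPolynomial.C - C (MvPolynomial.X i : Poly)).map
      (MvPolynomial.eval z) = r - C (z i) := by
    ext j
    simp
  rw [implicitEquation, ← resultant_map_map, hmap, hmap, natDegree_sub_C, natDegree_sub_C]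

theorem exists_isRoot_iff_resultant_eq_zero {p q : ℂ[X]} (hp : p ≠ 0) :
    (∃ ξ, p.IsRoot ξ ∧ q.IsRoot ξ) ↔ resultant p q p.natDegree q.natDegree = 0 := by
  rw [resultant_eq_zero_iff, isCoprime_iff_aeval_ne_zero_of_isAlgClosed ℂ ℂ]
  simp [hp, IsRoot.def]

theorem mem_curve_iff {p : ℂ[X]} (hp : p.natDegree ≠ 0) (q : ℂ[X]) (z : Plane) :
    z ∈ curve p q ↔ MvPolynomial.eval z (implicitEquation p q) = 0 := by
  have hp0 : p - C (z 0) ≠ 0 := fun h0 =>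
    hp (by rw [← natDegree_sub_C, h0, natDegree_zero])
  rw [eval_implicitEquation, ← exists_isRoot_iff_resultant_eq_zero hp0]
  simp only [curve, Set.mem_range, funext_iff, Fin.forall_fin_two, IsRoot.def, eval_sub, eval_C,
    sub_eq_zero, Matrix.cons_val_zero, Matrix.cons_val_one]

theorem isClosed_curve {p : ℂ[X]} (hp : p.natDegree ≠ 0) (q : ℂ[X]) :
    @IsClosed Plane zariski (curve p q) := by
  refine @IsClosed.mk Plane zariski _ (TopologicalSpace.isOpen_generateFrom_of_mem
    ⟨implicitEquation p q, Set.ext fun z => ?_⟩)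
  rw [Set.mem_compl_iff, mem_curve_iff hp, Set.mem_ofPred_eq]

theorem IsIrreducibleComponent.mem_of_subset_sUnion {Z S : Set Plane}
    (hZ : IsIrreducibleComponent Z S) {T : Set (Set Plane)} (hT : T.Finite)
    (hirr : ∀ C ∈ T, @IsIrreducible Plane zariski C) (hclosed : ∀ C ∈ T, @IsClosed Plane zariski C)
    (hTS : ∀ C ∈ T, C ⊆ S) (hST : S ⊆ ⋃₀ T) : Z ∈ T := by
  obtain ⟨C, hC, hZC⟩ := (@isIrreducible_iff_sUnion_isClosed Plane zariski Z).1 hZ.prop.2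
    hT.toFinset (fun C hC => hclosed C (hT.mem_toFinset.1 hC))
    (by rw [hT.coe_toFinset]; exact hZ.prop.1.trans hST)
  rw [hT.mem_toFinset] at hC
  rwa [hZ.eq_of_subset ⟨hTS C hC, hirr C hC⟩ hZC]

end ZariskiCurves

section Normalization

open NewtonChain

theorem exists_pow_eq_of_coprime {𝕜 : Type*} [Field 𝕜] {d e : ℕ} (hde : Nat.Coprime d e) {s t : 𝕜}
    (hs : s ≠ 0) (ht : t ≠ 0) (h : s ^ e = t ^ d) :
    ∃ r : 𝕜, r ≠ 0 ∧ r ^ d = s ∧ r ^ e = t := by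
  have hb : (d : ℤ) * d.gcdA e + e * d.gcdB e = 1 := by
    rw [← Nat.gcd_eq_gcd_ab, hde, Nat.cast_one]
  have h' : s ^ (e : ℤ) = t ^ (d : ℤ) := by rwa [zpow_natCast, zpow_natCast]
  refine ⟨s ^ d.gcdA e * t ^ d.gcdB e, mul_ne_zero (zpow_ne_zero _ hs) (zpow_ne_zero _ ht), ?_, ?_⟩
  · rw [← zpow_natCast, mul_zpow, ← zpow_mul, ← zpow_mul, mul_comm (d.gcdB e), zpow_mul t, ← h',
      ← zpow_mul, ← zpow_add₀ hs, mul_comm (d.gcdA e), hb, zpow_one]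
  · rw [← zpow_natCast, mul_zpow, ← zpow_mul, ← zpow_mul, mul_comm (d.gcdA e), zpow_mul s, h',
      ← zpow_mul, ← zpow_add₀ ht, mul_comm (d.gcdB e), hb, zpow_one]

/-- `Z` is parametrized by polynomials whose leading terms are `A * ξ ^ (m * d)` and
`B * ξ ^ (m * e)` for some `m ≥ 1`. -/
def HasNormalizedParametrization (A B : ℂ) (d e : ℕ) (Z : Set Plane) : Prop :=
  ∃ m : ℕ, 1 ≤ m ∧ ∃ p q : ℂ[X], p.natDegree = m * d ∧ p.leadingCoeff = A ∧
    q.natDegree = m * e ∧ q.leadingCoeff = B ∧ Z = curve p q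

theorem curve_comp_C_mul_X (p q : ℂ[X]) {c : ℂ} (hc : c ≠ 0) :
    curve (p.comp (C c * X)) (q.comp (C c * X)) = curve p q := by
  refine Set.Subset.antisymm ?_ ?_ <;> rintro _ ⟨ξ, rfl⟩
  · exact ⟨c * ξ, by simp⟩
  · exact ⟨c⁻¹ * ξ, by simp [hc]⟩

theorem hasNormalizedParametrization_curve {p q : ℂ[X]} {d e M α β : ℕ}
    {A B : ℂ} (h : IsProportional A B d e M α p β q) (hde : Nat.Coprime d e) (hA : A ≠ 0)
    (hB : B ≠ 0) (hp : p ≠ 0) (hq : q ≠ 0) (hM : M ≠ 0) :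
    HasNormalizedParametrization A B d e (curve p q) := by
  have hp₁ := leadingCoeff_ne_zero.2 hp
  have hq₁ := leadingCoeff_ne_zero.2 hq
  obtain ⟨r, hr, hrd, hre⟩ :=
    exists_pow_eq_of_coprime hde (div_ne_zero hA hp₁) (div_ne_zero hB hq₁) <| by
      rw [div_pow, div_pow, div_eq_div_iff (pow_ne_zero _ hp₁) (pow_ne_zero _ hq₁),
        h.leadingCoeff_eq]
  obtain ⟨c, rfl⟩ := IsAlgClosed.exists_pow_nat_eq r (Nat.pos_of_ne_zero hM)
  have hc : c ≠ 0 := (pow_ne_zero_iff hM).1 hr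
  have hdeg : (C c * X : ℂ[X]).natDegree = 1 := natDegree_C_mul_X c hc
  have hlead (f : ℂ[X]) : (f.comp (C c * X)).leadingCoeff = f.leadingCoeff * c ^ f.natDegree := by
    rw [leadingCoeff_comp (hdeg.trans_ne one_ne_zero), leadingCoeff_C_mul_X]
  refine ⟨M, Nat.one_le_iff_ne_zero.2 hM, p.comp (C c * X), q.comp (C c * X), ?_, ?_, ?_, ?_,
    (curve_comp_C_mul_X p q hc).symm⟩
  · rw [natDegree_comp, hdeg, mul_one, h.natDegree_left, mul_comm]
  · rw [hlead, h.natDegree_left, mul_comm d, pow_mul, hrd, mul_div_cancel₀ _ hp₁]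
  · rw [natDegree_comp, hdeg, mul_one, h.natDegree_right, mul_comm]
  · rw [hlead, h.natDegree_right, mul_comm e, pow_mul, hre, mul_div_cancel₀ _ hq₁]

theorem HasNormalizedParametrization.isIrreducible {A B : ℂ} {d e : ℕ} {Z : Set Plane}
    (h : HasNormalizedParametrization A B d e Z) : @IsIrreducible Plane zariski Z := by
  obtain ⟨-, -, p, q, -, -, -, -, rfl⟩ := h
  exact isIrreducible_curve p q

theorem HasNormalizedParametrization.isClosed {A B : ℂ} {d e : ℕ} {Z : Set Plane}
    (h : HasNormalizedParametrization A B d e Z) (hd : d ≠ 0) : @IsClosed Plane zariski Z := by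
  obtain ⟨m, hm, p, q, hp, -, -, -, rfl⟩ := h
  exact isClosed_curve (hp.trans_ne (mul_ne_zero (Nat.one_le_iff_ne_zero.1 hm) hd)) q

end Normalization

section Cover

open Asymptotics Filter NewtonChain Puiseux

theorem exists_forall_isBigO {γ ι E : Type*} [Finite ι] [Nonempty ι] [Norm E] (l : Ultrafilter γ)
    (f : ι → γ → E) : ∃ j, ∀ i, f j =O[l] f i := by
  obtain ⟨j, hj⟩ := Ultrafilter.eventually_exists_iff.1
    (Eventually.of_forall (f := (l : Filter γ)) fun s => Finite.exists_min fun i => ‖f i s‖)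
  exact ⟨j, fun i => .of_bound' (hj.mono fun s hs => hs i)⟩

variable {P Q : Poly} {K d e m N S : ℕ} {A B : ℂ} {ι κ : Type*} [Fintype ι] [Fintype κ]
  {u : ι → ℂ[X]} {v : κ → ℂ[X]}

theorem exists_finite_curves_of_center
    (hJ : ∃ j : ℂ[X], jacobian P Q = aeval (MvPolynomial.X 0 : Poly) j)
    (hP : P.totalDegree ≤ d * K) (hQ : Q.totalDegree ≤ e * K) (hde : Nat.Coprime d e)
    (hd : d ≠ 0) (he : e ≠ 0) (hK : K ≠ 0) (hm : m ≠ 0) (hA : A ≠ 0) (hB : B ≠ 0)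
    (hι : Fintype.card ι = d * K) (hκ : Fintype.card κ = e * K)
    (hu : HasApproxRoots (chartAtInfinity m (d * K) P) A u N)
    (hv : HasApproxRoots (chartAtInfinity m (e * K) Q) B v N)
    (hNd : d * (m * K) < N) (hNe : e * (m * K) < N) (w : ℂ[X])
    (hS : ∀ i, w - u i ≠ 0 → S ∣ (w - u i).natTrailingDegree)
    (hιS : (Fintype.card ι).factorial ∣ S) (hSm : S ∣ m) :
    ∃ T : Set (Set Plane), T.Finite ∧
      (∀ C ∈ T, HasNormalizedParametrization A B d e C ∧
        C ⊆ nonProperValueSet (polyMap P Q)) ∧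
      ∀ {γ : Type} {l : Ultrafilter γ} {t Y : γ → ℂ} {a : Plane}, IsBranch m P Q l t Y a →
        (∀ i, (fun s => Y s - w.eval (t s)) =O[l] fun s => Y s - (u i).eval (t s)) →
        (∀ i, (fun s => Y s - w.eval (t s)) =O[l] fun s => Y s - (v i).eval (t s)) → a ∈ ⋃₀ T := by
  by_cases hgood : (∃ k, d * (m * K) ≤ totalOrder (fun i => w - u i) k) ∧
      ∃ k, e * (m * K) ≤ totalOrder (fun i => w - v i) k
  · obtain ⟨j, hj⟩ := hJ
    obtain ⟨r, hr⟩ := exists_weightedWronskian_chartAtInfinity_eq m hP hQ hj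
    rw [mul_left_comm m, mul_left_comm m] at hr
    obtain ⟨k, M, hM, hk, hk', hprop⟩ := exists_isProportional_residuePoly hde hd he
      (mul_ne_zero hm hK) hA hB hι hκ hu hv hNd hNe hr hS hιS (hSm.mul_right K) hgood.1 hgood.2
    have hp := HasLeadingForm.of_hasApproxRoots hu (hk.trans_lt hNd)
    have hq := HasLeadingForm.of_hasApproxRoots hv (hk'.trans_lt hNe)
    rw [hk, mul_left_comm] at hp
    rw [hk', mul_left_comm] at hq
    have hpdeg := hprop.natDegree_left.trans_ne (mul_ne_zero hd hM)
    have hqdeg := hprop.natDegree_right.trans_ne (mul_ne_zero he hM)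
    refine ⟨{curve (residuePoly A (fun i => w - u i) k) (residuePoly B (fun i => w - v i) k)},
      Set.finite_singleton _, ?_, fun {γ l t Y a} h hnear _ => ?_⟩
    · rintro _ rfl
      exact ⟨hasNormalizedParametrization_curve hprop hde hA hB
        (ne_of_apply_ne natDegree (by rwa [natDegree_zero]))
        (ne_of_apply_ne natDegree (by rwa [natDegree_zero])) hM,
        curve_subset_nonProperValueSet hm hP hQ hp hq⟩
    · have hG := h.isBigO_evalEval_left hP
      rw [mul_left_comm] at hG
      rw [Set.sUnion_singleton]
      exact h.mem_curve hP hQ hp hq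
        (isBigO_one_of_totalOrder_eq hu hA hNd.le h.tendsto_nhdsNE h.isBigO_one hG hnear hk hpdeg)
  · refine ⟨∅, Set.finite_empty, by simp, fun {γ l t Y a} h hnear hnear' => (hgood ?_).elim⟩
    have hG := h.isBigO_evalEval_left hP
    have hH := h.isBigO_evalEval_right hQ
    rw [mul_left_comm] at hG hH
    exact ⟨⟨_, le_totalOrder_of_hasApproxRoots hu hA hNd.le h.tendsto_nhdsNE h.isBigO_one hG hnear⟩,
      ⟨_, le_totalOrder_of_hasApproxRoots hv hB hNe.le h.tendsto_nhdsNE h.isBigO_one hH hnear'⟩⟩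

theorem exists_finite_cover
    (hJ : ∃ j : ℂ[X], jacobian P Q = aeval (MvPolynomial.X 0 : Poly) j)
    (hP : P.totalDegree ≤ d * K) (hQ : Q.totalDegree ≤ e * K) (hde : Nat.Coprime d e)
    (hd : d ≠ 0) (he : e ≠ 0) (hK : K ≠ 0) (hPy : IsMonicInY P (d * K) A)
    (hQy : IsMonicInY Q (e * K) B) :
    ∃ T : Set (Set Plane), T.Finite ∧
      (∀ C ∈ T, HasNormalizedParametrization A B d e C ∧
        C ⊆ nonProperValueSet (polyMap P Q)) ∧
      nonProperValueSet (polyMap P Q) ⊆ ⋃₀ T := by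
  have hdK : d * K ≠ 0 := mul_ne_zero hd hK
  obtain ⟨m, hm, hSm, hroots⟩ :=
    hPy.exists_common_hasApproxRoots hQy (d * K).factorial (Nat.factorial_ne_zero _)
  obtain ⟨u, v, hu, hv⟩ := hroots (d * (m * K) + e * (m * K) + 1)
  let W (j : Fin (d * K) ⊕ Fin (e * K)) : ℂ[X] := expand ℂ (d * K).factorial (Sum.elim u v j)
  have hS (j) (i) (hi : W j - W (.inl i) ≠ 0) :
      (d * K).factorial ∣ (W j - W (.inl i)).natTrailingDegree := by
    simp only [W, ← map_sub] at hi ⊢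
    exact dvd_natTrailingDegree_expand (Nat.factorial_ne_zero _) hi
  choose T hT hTC hcover using fun j => exists_finite_curves_of_center hJ hP hQ hde hd he hK hm
    hPy.1 hQy.1 (Fintype.card_fin _) (Fintype.card_fin _) hu hv (by lia) (by lia) (W j) (hS j)
    (by rw [Fintype.card_fin]) hSm
  refine ⟨⋃ j, T j, Set.finite_iUnion hT, fun C hC => ?_, fun a ha => ?_⟩
  · obtain ⟨j, hj⟩ := Set.mem_iUnion.1 hC
    exact hTC j C hj
  · obtain ⟨l, t, Y, hbranch⟩ := exists_isBranch hdK hm hP hPy ha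
    have : Nonempty (Fin (d * K) ⊕ Fin (e * K)) := ⟨.inl ⟨0, Nat.pos_of_ne_zero hdK⟩⟩
    obtain ⟨j, hj⟩ := exists_forall_isBigO l fun j z => Y z - (W j).eval (t z)
    exact Set.sUnion_mono (Set.subset_iUnion T j)
      (hcover j hbranch (fun i => hj (.inl i)) fun i => hj (.inr i))

end Cover

theorem totalDegree_ne_zero_of_jacobian_ne_zero {P Q : Poly} (h : jacobian P Q ≠ 0) :
    P.totalDegree ≠ 0 ∧ Q.totalDegree ≠ 0 := by
  constructor <;> intro h0 <;> refine h ?_ <;>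
    rw [jacobian, MvPolynomial.totalDegree_eq_zero_iff_eq_C.1 h0] <;> simp

end PlanePoly

theorem theorem1_general (P Q : PlanePoly.Poly) (K d e : ℕ) (A B : ℂ)
    (hJ : ∃ j : ℂ[X], PlanePoly.jacobian P Q = aeval (MvPolynomial.X 0 : PlanePoly.Poly) j)
    (hP : P.totalDegree = K * d) (hQ : Q.totalDegree = K * e)
    (hP₀ : P.totalDegree ≠ 0) (hQ₀ : Q.totalDegree ≠ 0)
    (hde : Nat.gcd d e = 1)
    (hPy : PlanePoly.IsMonicInY P (K * d) A)
    (hQy : PlanePoly.IsMonicInY Q (K * e) B) :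
    ∀ Z : Set PlanePoly.Plane,
      PlanePoly.IsIrreducibleComponent Z
        (PlanePoly.nonProperValueSet (PlanePoly.polyMap P Q)) →
      ∃ m : ℕ, 1 ≤ m ∧ ∃ p q : Polynomial ℂ,
        p.natDegree = m * d ∧ p.leadingCoeff = A ∧
        q.natDegree = m * e ∧ q.leadingCoeff = B ∧
        Z = Set.range (fun ξ : ℂ => (![p.eval ξ, q.eval ξ] : PlanePoly.Plane)) := by
  intro Z hZ
  rw [hP] at hP₀
  rw [hQ] at hQ₀
  rw [mul_comm K] at hP hQ hPy hQy
  obtain ⟨hK, hd⟩ := mul_ne_zero_iff.1 hP₀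
  obtain ⟨T, hT, hTC, hcover⟩ := PlanePoly.exists_finite_cover hJ hP.le hQ.le hde hd
    (right_ne_zero_of_mul hQ₀) hK hPy hQy
  exact (hTC Z (hZ.mem_of_subset_sUnion hT (fun C hC => (hTC C hC).1.isIrreducible)
    (fun C hC => (hTC C hC).1.isClosed hd) (fun C hC => (hTC C hC).2) hcover)).1

theorem theorem1 (P Q : PlanePoly.Poly) (K d e : ℕ) (A B : ℂ)
    (hJ : ∃ c : ℂ, c ≠ 0 ∧ PlanePoly.jacobian P Q = MvPolynomial.C c)
    (hP : P.totalDegree = K * d) (hQ : Q.totalDegree = K * e)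
    (hde : Nat.gcd d e = 1)
    (hPy : PlanePoly.IsMonicInY P (K * d) A)
    (hQy : PlanePoly.IsMonicInY Q (K * e) B)
    (hne : (PlanePoly.nonProperValueSet (PlanePoly.polyMap P Q)).Nonempty) :
    ∀ Z : Set PlanePoly.Plane,
      PlanePoly.IsIrreducibleComponent Z
        (PlanePoly.nonProperValueSet (PlanePoly.polyMap P Q)) →
      ∃ m : ℕ, 1 ≤ m ∧ ∃ p q : Polynomial ℂ,
        p.natDegree = m * d ∧ p.leadingCoeff = A ∧
        q.natDegree = m * e ∧ q.leadingCoeff = B ∧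
        Z = Set.range (fun ξ : ℂ => (![p.eval ξ, q.eval ξ] : PlanePoly.Plane)) := by
  obtain ⟨c, hc, hJ⟩ := hJ
  obtain ⟨hP₀, hQ₀⟩ := PlanePoly.totalDegree_ne_zero_of_jacobian_ne_zero
    (hJ.trans_ne (MvPolynomial.C_ne_zero.2 hc))
  exact theorem1_general P Q K d e A B ⟨C c, hJ.trans (aeval_C _ c).symm⟩ hP hQ hP₀ hQ₀ hde hPy hQy
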